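/- **Setting.** Let $X$, $Y$, $\partial X$ be (real or complex) Banach spaces with a continuous embedding $Y\hookrightarrow X$, and assume the following. * $A:D(A)\to X$ is a linear operator whose domain $D(A)$ is a linear subspace of $Y$; $R:D(A)\to\partial X$ is linear and surjective. * $B_1,B_2:Y\to\partial X$ and $B_3,B_4:\partial X\to\partial X$ are bounded linear operators. * The operator $\binom{A}{R}:D(A)\subset Y\to X\times\partial X$ is closed. * The restriction $A_0:=A|_{\ker R}$, regarded as an operator on $X$, generates a strongly continuous cosine operator function $(C(t))_{t\in\mathbb R}$ on $X$ with associated phase space $Y\times X$; that is, $D(A_0)$ is the set of all $z\in X$ for which $A_0z=\lim_{t\to0}\frac{2}{t^2}(C(t)z-z)$ exists, $Y$ is the set of all $z\in X$ for which $C(\cdot)z$ is continuously differentiable, and the norm of $Y$ is equivalent to $\|z\|_X+\sup_{0\le t\le1}\|C'(t)z\|_X$. Put $L:=R+B_2|_{D(A)}:D(A)\to\partial X$. Consider the second order problem with acoustic boundary conditions $$(\mathrm{AIBVP}_2)\quad \begin{cases} \ddot u(t)=Au(t), & t\in\mathbb R,\\ \ddot x(t)=B_1u(t)+B_2\dot u(t)+B_3x(t)+B_4\dot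 x(t), & t\in\mathbb R,\\ \dot x(t)=Lu(t), & t\in\mathbb R,\\ u(0)=f,\ \dot u(0)=g,\quad x(0)=h,\ \dot x(0)=j, & \end{cases}$$ and, on $\mathbb X:=Y\times X\times\partial X$ and $\partial\mathbb X:=\partial X$, its first order reformulation $$(\mathbb{AIBVP})\quad \begin{cases} \dot{\mathbb u}(t)=\mathbb A\mathbb u(t), & t\in\mathbb R,\\ \dot{\mathbb x}(t)=\mathbb B\mathbb u(t)+\tilde{\mathbb B}\mathbb x(t), & t\in\mathbb R,\\ \mathbb x(t)=\mathbb R\mathbb u(t), & t\in\mathbb R,\\ \mathbb u(0)=\mathbb u_0,\quad \mathbb x(0)=\mathbb x_0, & \end{cases}$$ where $$\mathbb A=\begin{pmatrix}0&I_Y&0\\A&0&0\\L&0&0\end{pmatrix},\quad D(\mathbb A)=D(A)\times Y\times\partial X,\qquad \mathbb R=\begin{pmatrix}R&0&0\end{pmatrix},\quad D(\mathbb R)=D(\mathbb A),$$ $$\mathbb B=\begin{pmatrix}B_1+B_4B_2&0&B_3\end{pmatrix}\in\mathcal L(\mathbb X,\partial\mathbb X),\qquad \tilde{\mathbb B}=B_4\in\mathcal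 L(\partial\mathbb X).$$ Let $\mathcal A$ be the one-sided coupled operator matrix on $\mathbb X\times\partial\mathbb X$ given by $$\mathcal A=\begin{pmatrix}\mathbb A&0\\ \mathbb B&\tilde{\mathbb B}\end{pmatrix},\qquad D(\mathcal A)=\Big\{\tbinom{\mathbb u}{\mathbb x}\in D(\mathbb A)\times\partial\mathbb X:\ \mathbb R\mathbb u=\mathbb x\Big\}.$$ A *classical solution* of $(\mathbb{AIBVP})$ is a function $\mathbb u\in C^1(\mathbb R,\mathbb X)$ with values in $D(\mathbb A)$ and with $\mathbb x:=\mathbb R\mathbb u\in C^1(\mathbb R,\partial\mathbb X)$ that satisfies the problem pointwise. A *classical solution* of $(\mathrm{AIBVP}_2)$ is a function $u\in C^2(\mathbb R,X)\cap C^1(\mathbb R,Y)$ with values in $D(A)$ and with $Lu\in C^1(\mathbb R,\partial X)$ that, together with a function $x\in C^2(\mathbb R,\partial X)$ (necessarily $x(t)=h+\int_0^tLu(s)\,ds$), satisfies the problem pointwise. **Proposition.** Under these assumptions the following hold. 1. $(\mathbb{AIBVP})$ is well-posed: $\mathcal A$ is closed and densely defined; for all $\mathbb u_0\in D(\mathbb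 A)$ and $\mathbb x_0=\mathbb R\mathbb u_0$ there is exactly one classical solution; and for every $T>0$ there is a constant $K$ such that every classical solution satisfies $\|\mathbb u(t)\|+\|\mathbb R\mathbb u(t)\|\le K(\|\mathbb u_0\|+\|\mathbb x_0\|)$ for $|t|\le T$. 2. $(\mathrm{AIBVP}_2)$ is well-posed: the admissible initial data, i.e. the $(f,g,h,j)$ with $f\in D(A)$, $g\in Y$, $h\in\partial X$, $j=Lf$, are dense in $Y\times X\times\partial X\times\partial X$; for all such data there is exactly one classical solution; and for every $T>0$ there is a constant $K$ such that every classical solution satisfies $\|u(t)\|_Y+\|\dot u(t)\|_X+\|x(t)\|+\|\dot x(t)\|\le K(\|f\|_Y+\|g\|_X+\|h\|+\|j\|)$ for $|t|\le T$. 3. $\mathcal A$ generates a $C_0$-group on $\mathbb X\times\partial\mathbb X$. -/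

import Mathlib

open Set Filter Topology

noncomputable section

namespace AcousticBC

/-! ### Unbounded operators given by a parametrization of their domain -/

section Param

variable {𝕜 P E F : Type*} [RCLike 𝕜] [AddCommGroup P] [Module 𝕜 P]
  [AddCommGroup E] [Module 𝕜 E] [AddCommGroup F] [Module 𝕜 F]

/-- The linear operator from `E` to `F` with domain `range j` that maps `j p` to `a p`,
for an injective linear map `j`. -/
def paramOp (j : P →ₗ[𝕜] E) (hj : Function.Injective j) (a : P →ₗ[𝕜] F) : E →ₗ.[𝕜] F where
  domain := LinearMap.range j
  toFun := a ∘ₗ (LinearEquiv.ofInjective j hj).symm.toLinearMap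

theorem mem_graph_paramOp (j : P →ₗ[𝕜] E) (hj : Function.Injective j) (a : P →ₗ[𝕜] F)
    (z : E × F) : z ∈ (paramOp j hj a).graph ↔ ∃ p, (j p, a p) = z := by
  rw [LinearPMap.mem_graph_iff]
  constructor
  · rintro ⟨⟨y, p, rfl⟩, h1, h2⟩
    refine ⟨p, Prod.ext h1 ?_⟩
    rw [← h2]
    change a p = a ((LinearEquiv.ofInjective j hj).symm (LinearEquiv.ofInjective j hj p))
    rw [LinearEquiv.symm_apply_apply]
  · rintro ⟨p, rfl⟩
    refine ⟨⟨j p, p, rfl⟩, rfl, ?_⟩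
    change a ((LinearEquiv.ofInjective j hj).symm (LinearEquiv.ofInjective j hj p)) = a p
    rw [LinearEquiv.symm_apply_apply]

end Param

/-! ### Strongly continuous groups and cosine operator functions -/

section Generators

variable {𝕜 E V : Type*} [RCLike 𝕜]
  [NormedAddCommGroup E] [NormedSpace ℝ E] [NormedSpace 𝕜 E]
  [NormedAddCommGroup V] [NormedSpace 𝕜 V]

/-- `T` is a strongly continuous group (`C₀`-group) of bounded linear operators on `E`. -/
structure IsC0Group (T : ℝ → E →L[𝕜] E) : Prop where
  map_zero : T 0 = ContinuousLinearMap.id 𝕜 E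
  map_add : ∀ s t, T (s + t) = (T s).comp (T t)
  strongly_continuous : ∀ z, Continuous fun t => T t z

/-- `G` is the generator of a `C₀`-group `T`: one has `z ∈ D(G)` and `G z = w` if and only if
`w` is the limit of `(T t z - z) / t` as `t → 0`. -/
def GeneratesC0Group (G : E →ₗ.[𝕜] E) : Prop :=
  ∃ T : ℝ → E →L[𝕜] E, IsC0Group T ∧
    ∀ z w, (z, w) ∈ G.graph ↔ HasDerivAt (fun t => T t z) w 0

/-- `C` is a (strongly continuous) cosine operator function on `E`. -/
structure IsCosineFunction (C : ℝ → E →L[𝕜] E) : Prop where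
  map_zero : C 0 = ContinuousLinearMap.id 𝕜 E
  dAlembert : ∀ s t z, C (t + s) z + C (t - s) z = (2 : ℝ) • C t (C s z)
  strongly_continuous : ∀ z, Continuous fun t => C t z

/-- `G` is the generator of the cosine operator function `C`: one has `z ∈ D(G)` and `G z = w`
if and only if `w` is the limit of `(2 / t²) (C t z - z)` as `t → 0`. -/
def IsCosineGenerator (C : ℝ → E →L[𝕜] E) (G : E →ₗ.[𝕜] E) : Prop :=
  ∀ z w, (z, w) ∈ G.graph ↔
    Tendsto (fun t : ℝ => (2 / t ^ 2) • (C t z - z)) (𝓝[≠] 0) (𝓝 w)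

/-- `V × E` is the phase space associated with the cosine function `C` on `E`, where `V` is
embedded in `E` by `ι`: the space `V` consists of all `z` such that `C(·) z` is continuously
differentiable, and its norm is equivalent to `‖z‖ + sup_{0 ≤ t ≤ 1} ‖C'(t) z‖`. -/
def IsPhaseSpace (C : ℝ → E →L[𝕜] E) (ι : V →L[𝕜] E) : Prop :=
  (∀ z, z ∈ range ι ↔ ContDiff ℝ 1 fun t => C t z) ∧
  ∃ c K : ℝ, 0 < c ∧ ∀ v,
    c * ‖v‖ ≤ ‖ι v‖ + ⨆ t : Icc (0 : ℝ) 1, ‖deriv (fun s => C s (ι v)) t‖ ∧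
    ‖ι v‖ + ⨆ t : Icc (0 : ℝ) 1, ‖deriv (fun s => C s (ι v)) t‖ ≤ K * ‖v‖

end Generators

/-! ### First order abstract initial-boundary value problems -/

section FirstOrder

variable (𝕜 : Type*) [RCLike 𝕜]
  (E dE : Type*) [NormedAddCommGroup E] [NormedSpace 𝕜 E]
  [NormedAddCommGroup dE] [NormedSpace 𝕜 dE]

/-- The operators of a first order abstract initial-boundary value problem
`u' = 𝔸 u`, `x' = 𝔹 u + 𝔹' x`, `x = ℝ u` on the spaces `E` and `dE`. -/
structure FirstOrderProblem where
  op : E →ₗ.[𝕜] E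
  bdry : op.domain →ₗ[𝕜] dE
  feedback : E →L[𝕜] dE
  bdryOp : dE →L[𝕜] dE

variable {𝕜 E dE}

namespace FirstOrderProblem

variable (P : FirstOrderProblem 𝕜 E dE)

theorem graph_injective : Function.Injective (P.op.domain.subtype.prod P.bdry) :=
  fun _ _ h => Subtype.ext (congrArg Prod.fst h)

/-- The operator matrix `(𝔸 0; 𝔹 𝔹')` on `E × dE` with the (coupled) domain
`{(u, x) ∈ D(𝔸) × dE : ℝ u = x}`. -/
def matrix : (E × dE) →ₗ.[𝕜] (E × dE) :=
  paramOp (P.op.domain.subtype.prod P.bdry)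
    P.graph_injective
    (P.op.toFun.prod
      (P.feedback.toLinearMap ∘ₗ P.op.domain.subtype + P.bdryOp.toLinearMap ∘ₗ P.bdry))

variable [NormedSpace ℝ E] [NormedSpace ℝ dE]

/-- `u` is a classical solution on the whole time axis with initial data `u(0) = u₀`,
`x(0) = x₀`, where `x(t) = ℝ u(t)`. -/
structure IsClassicalSolution (u₀ : E) (x₀ : dE) (u : ℝ → E) : Prop where
  contDiff : ContDiff ℝ 1 u
  mem : ∀ t, u t ∈ P.op.domain
  contDiff_bdry : ContDiff ℝ 1 fun t => P.bdry ⟨u t, mem t⟩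
  deriv_eq : ∀ t, deriv u t = P.op ⟨u t, mem t⟩
  deriv_bdry_eq : ∀ t, deriv (fun s => P.bdry ⟨u s, mem s⟩) t =
    P.feedback (u t) + P.bdryOp (P.bdry ⟨u t, mem t⟩)
  initial : u 0 = u₀
  initial_bdry : P.bdry ⟨u 0, mem 0⟩ = x₀

/-- Well-posedness: the operator matrix is closed and densely defined, every admissible initial
datum has exactly one classical solution, and the solutions depend continuously on the initial
data, uniformly on compact time intervals. -/
structure WellPosed : Prop where
  closed : P.matrix.IsClosed
  dense : Dense (P.matrix.domain : Set (E × dE))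
  existsUnique : ∀ (u₀ : E) (hu₀ : u₀ ∈ P.op.domain) (x₀ : dE), P.bdry ⟨u₀, hu₀⟩ = x₀ →
    ∃! u : ℝ → E, P.IsClassicalSolution u₀ x₀ u
  continuous_dependence : ∀ T : ℝ, ∃ K : ℝ, ∀ (u₀ : E) (x₀ : dE) (u : ℝ → E)
    (hu : P.IsClassicalSolution u₀ x₀ u), ∀ t ∈ Icc (-T) T,
      ‖u t‖ + ‖P.bdry ⟨u t, hu.mem t⟩‖ ≤ K * (‖u₀‖ + ‖x₀‖)

end FirstOrderProblem

end FirstOrder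

/-! ### The abstract second order problem with acoustic boundary conditions -/

section SecondOrder

variable (𝕜 : Type*) [RCLike 𝕜]
  (Y X dX : Type*)
  [NormedAddCommGroup Y] [NormedSpace 𝕜 Y]
  [NormedAddCommGroup X] [NormedSpace 𝕜 X]
  [NormedAddCommGroup dX] [NormedSpace 𝕜 dX]

/-- The operators of the second order problem: the embedding `ι` of `Y` in `X`, the operator
`A : D(A) ⊆ Y → X`, the boundary operator `R : D(A) → dX`, and bounded operators `B₁, …, B₄`. -/
structure AcousticData where
  ι : Y →L[𝕜] X
  ι_injective : Function.Injective ι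
  A : Y →ₗ.[𝕜] X
  R : A.domain →ₗ[𝕜] dX
  B₁ : Y →L[𝕜] dX
  B₂ : Y →L[𝕜] dX
  B₃ : dX →L[𝕜] dX
  B₄ : dX →L[𝕜] dX

variable {𝕜 Y X dX}

namespace AcousticData

variable (S : AcousticData 𝕜 Y X dX)

/-- `L = R + B₂` on `D(A)`. -/
def L : S.A.domain →ₗ[𝕜] dX := S.R + S.B₂.toLinearMap ∘ₗ S.A.domain.subtype

/-- The operator `(A; R) : D(A) ⊆ Y → X × dX`. -/
def opAR : Y →ₗ.[𝕜] (X × dX) := ⟨S.A.domain, S.A.toFun.prod S.R⟩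

theorem inclKer_injective : Function.Injective
    (S.ι.toLinearMap ∘ₗ S.A.domain.subtype ∘ₗ (LinearMap.ker S.R).subtype) :=
  fun _ _ h => Subtype.ext (Subtype.ext (S.ι_injective h))

/-- The restriction `A₀` of `A` to `ker R`, as an operator on `X`. -/
def A₀ : X →ₗ.[𝕜] X :=
  paramOp (S.ι.toLinearMap ∘ₗ S.A.domain.subtype ∘ₗ (LinearMap.ker S.R).subtype)
    S.inclKer_injective
    (S.A.toFun ∘ₗ (LinearMap.ker S.R).subtype)

/-- The inclusion of `D(A) × Y × dX` in `Y × X × dX`. -/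
def incl : (S.A.domain × Y × dX) →ₗ[𝕜] (Y × X × dX) :=
  S.A.domain.subtype.prodMap (S.ι.toLinearMap.prodMap LinearMap.id)

theorem incl_injective : Function.Injective S.incl := by
  rintro ⟨u, v, x⟩ ⟨u', v', x'⟩ h
  obtain ⟨h1, h2, h3⟩ : (u : Y) = u' ∧ S.ι v = S.ι v' ∧ x = x' := by
    simpa [incl] using h
  rw [Subtype.ext h1, S.ι_injective h2, h3]

/-- The first order reformulation on `Y × X × dX` and `dX`:
`𝔸 = (0 I 0; A 0 0; L 0 0)` with domain `D(A) × Y × dX`, `ℝ = (R 0 0)` with the same domain,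
`𝔹 = (B₁ + B₄ B₂, 0, B₃)`, and `𝔹' = B₄`. -/
def firstOrder : FirstOrderProblem 𝕜 (Y × X × dX) dX where
  op := paramOp S.incl S.incl_injective
    ((LinearMap.fst 𝕜 Y dX ∘ₗ LinearMap.snd 𝕜 S.A.domain (Y × dX)).prod
      ((S.A.toFun ∘ₗ LinearMap.fst 𝕜 S.A.domain (Y × dX)).prod
        (S.L ∘ₗ LinearMap.fst 𝕜 S.A.domain (Y × dX))))
  bdry := S.R ∘ₗ LinearMap.fst 𝕜 S.A.domain (Y × dX) ∘ₗ
    (LinearEquiv.ofInjective S.incl S.incl_injective).symm.toLinearMap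
  feedback := (S.B₁ + S.B₄.comp S.B₂).comp (ContinuousLinearMap.fst 𝕜 Y (X × dX)) +
    S.B₃.comp ((ContinuousLinearMap.snd 𝕜 X dX).comp (ContinuousLinearMap.snd 𝕜 Y (X × dX)))
  bdryOp := S.B₄

variable [NormedSpace ℝ Y] [NormedSpace ℝ X] [NormedSpace ℝ dX]

/-- The standing assumptions on the operators. (Linearity, boundedness of `ι, B₁, …, B₄`, and
`D(A) ⊆ Y` are already part of the data.) -/
structure Assumptions : Prop where
  surjective : Function.Surjective S.R
  closed : S.opAR.IsClosed
  cosine : ∃ C : ℝ → X →L[𝕜] X,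
    IsCosineFunction C ∧ IsCosineGenerator C S.A₀ ∧ IsPhaseSpace C S.ι

/-- The pair `(u, x)` is a classical solution on `(Y, X, dX)` of
`u'' = A u`, `x'' = B₁ u + B₂ u' + B₃ x + B₄ x'`, `x' = L u` on the whole time axis, with
`u(0) = f`, `u'(0) = g`, `x(0) = h`, `x'(0) = j`. -/
structure IsClassicalSolution (f g : Y) (h j : dX) (u : ℝ → Y) (x : ℝ → dX) : Prop where
  contDiff_two : ContDiff ℝ 2 fun t => S.ι (u t)
  contDiff_one : ContDiff ℝ 1 u
  mem : ∀ t, u t ∈ S.A.domain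
  contDiff_L : ContDiff ℝ 1 fun t => S.L ⟨u t, mem t⟩
  contDiff_bdry : ContDiff ℝ 2 x
  interior : ∀ t, deriv (deriv fun s => S.ι (u s)) t = S.A ⟨u t, mem t⟩
  boundary : ∀ t, deriv (deriv x) t =
    S.B₁ (u t) + S.B₂ (deriv u t) + S.B₃ (x t) + S.B₄ (deriv x t)
  coupling : ∀ t, deriv x t = S.L ⟨u t, mem t⟩
  initial_u : u 0 = f
  initial_u' : deriv u 0 = g
  initial_x : x 0 = h
  initial_x' : deriv x 0 = j

/-- Well-posedness of the second order problem: the admissible initial data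
(`f ∈ D(A)`, `g ∈ Y`, `h, j ∈ dX`, `L f = j`) are dense in `Y × X × dX × dX`, each of them has
exactly one classical solution, and the solutions depend continuously on the initial data,
uniformly on compact time intervals. -/
structure WellPosed₂ : Prop where
  dense : Dense {z : Y × X × dX × dX | ∃ (f : S.A.domain) (g : Y) (h : dX),
    z = ((f : Y), S.ι g, h, S.L f)}
  existsUnique : ∀ (f : Y) (hf : f ∈ S.A.domain) (g : Y) (h j : dX), S.L ⟨f, hf⟩ = j →
    ∃! p : (ℝ → Y) × (ℝ → dX), S.IsClassicalSolution f g h j p.1 p.2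
  continuous_dependence : ∀ T : ℝ, ∃ K : ℝ, ∀ (f g : Y) (h j : dX) (u : ℝ → Y) (x : ℝ → dX),
    S.IsClassicalSolution f g h j u x → ∀ t ∈ Icc (-T) T,
      ‖u t‖ + ‖S.ι (deriv u t)‖ + ‖x t‖ + ‖deriv x t‖ ≤ K * (‖f‖ + ‖S.ι g‖ + ‖h‖ + ‖j‖)

end AcousticData

end SecondOrder

end AcousticBC

end

noncomputable section

/-!
The phase space `Y × X` of the cosine function `C` of `A₀` carries the group
`(y, v) ↦ (C(t) y + S(t) v, C'(t) y + C(t) v)` with `S(t) = ∫₀ᵗ C(s) ds`, whose generator is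
`(y, v) ↦ (v, A₀ y)`. Its resolvent yields a scalar `c` for which `A u - c u = f`, `R u = 0` is
uniquely solvable. Since `R` is surjective, `A u = c u`, `R u = x` is then uniquely solvable as
well, and its solution operator `D` from `dX` to `Y` is bounded by the closed graph theorem. The
substitution `u = w + D x` turns the coupling `R u = x` into `R w = 0`, and thereby the operator
matrix into a bounded perturbation of the direct sum of the generator of the phase space group and
`0`; a Dyson series in the interaction picture shows that it generates a group. This group solves
the first order problem, and the second order problem is equivalent to the first order problem
under `v = u'` and `R u = x' - B₂ u`.
-/

namespace AcousticBC

/-! ### Strongly continuous families of operators -/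

section Calculus

variable {E F : Type*} [NormedAddCommGroup E] [NormedSpace ℝ E]
  [NormedAddCommGroup F] [NormedSpace ℝ F]

theorem hasDerivAt_clm_apply {𝕜 : Type*} [RCLike 𝕜] [NormedSpace 𝕜 E] [IsScalarTower ℝ 𝕜 E]
    [NormedSpace 𝕜 F] [IsScalarTower ℝ 𝕜 F] (Φ : E →L[𝕜] F) {f : ℝ → E} {f' : E} {t : ℝ}
    (hf : HasDerivAt f f' t) : HasDerivAt (fun s => Φ (f s)) (Φ f') t :=
  (Φ.restrictScalars ℝ).hasFDerivAt.comp_hasDerivAt t hf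

theorem eq_of_hasDerivAt_eq {f g f' : ℝ → E} (hf : ∀ t, HasDerivAt f (f' t) t)
    (hg : ∀ t, HasDerivAt g (f' t) t) {t₀ : ℝ} (h₀ : f t₀ = g t₀) : f = g :=
  eq_of_fderiv_eq (fun t => (hf t).differentiableAt) (fun t => (hg t).differentiableAt)
    (fun t => by rw [(hf t).hasFDerivAt.fderiv, (hg t).hasFDerivAt.fderiv]) t₀ h₀

theorem hasDerivAt_integral_right [CompleteSpace E] {f : ℝ → E} (hf : Continuous f) (a t : ℝ) :
    HasDerivAt (fun u => ∫ s in a..u, f s) (f t) t :=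
  (hf.integral_hasStrictDerivAt a t).hasDerivAt

theorem contDiff_one_of_hasDerivAt {f f' : ℝ → E} (hf : ∀ t, HasDerivAt f (f' t) t)
    (hf' : Continuous f') : ContDiff ℝ 1 f :=
  contDiff_one_iff_deriv.2
    ⟨fun t => (hf t).differentiableAt, by rwa [funext fun t => (hf t).deriv]⟩

end Calculus

section StronglyContinuous

variable {𝕜 E F : Type*} [RCLike 𝕜]
  [NormedAddCommGroup E] [NormedSpace 𝕜 E] [NormedAddCommGroup F] [NormedSpace 𝕜 F]

/-- Continuity of a one-parameter family of operators in the strong operator topology. -/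
def StronglyContinuous (T : ℝ → E →L[𝕜] F) : Prop := ∀ z, Continuous fun t => T t z

namespace StronglyContinuous

variable {T : ℝ → E →L[𝕜] F}

theorem comp_neg (hT : StronglyContinuous T) : StronglyContinuous fun t => T (-t) :=
  fun z => (hT z).comp continuous_neg

theorem prod {F' : Type*} [NormedAddCommGroup F'] [NormedSpace 𝕜 F'] {T' : ℝ → E →L[𝕜] F'}
    (hT : StronglyContinuous T) (hT' : StronglyContinuous T') :
    StronglyContinuous fun t => (T t).prod (T' t) :=
  fun z => (hT z).prodMk (hT' z)

theorem norm_integral_apply_le [NormedSpace ℝ F] {M t : ℝ}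
    (hM : ∀ s ∈ Icc (-|t|) |t|, ‖T s‖ ≤ M) (z : E) :
    ‖∫ s in (0)..t, T s z‖ ≤ M * |t| * ‖z‖ := by
  have hsub : uIoc 0 t ⊆ Icc (-|t|) |t| := uIoc_subset_uIcc.trans
    (uIcc_subset_Icc ⟨by simp, by simp⟩ ⟨neg_abs_le t, le_abs_self t⟩)
  calc ‖∫ s in (0)..t, T s z‖ ≤ M * ‖z‖ * |t - 0| :=
        intervalIntegral.norm_integral_le_of_norm_le_const
          fun s hs => (T s).le_of_opNorm_le (hM s (hsub hs)) z
    _ = M * |t| * ‖z‖ := by rw [sub_zero]; ring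

variable [CompleteSpace E]

theorem exists_norm_le (hT : StronglyContinuous T) (a : ℝ) : ∃ M, ∀ t ∈ Icc (-a) a, ‖T t‖ ≤ M := by
  obtain ⟨M, hM⟩ := banach_steinhaus (g := fun t : Icc (-a) a => T t) fun z =>
    (isCompact_Icc.exists_bound_of_continuousOn (hT z).continuousOn).imp fun c hc t => hc t t.2
  exact ⟨M, fun t ht => hM ⟨t, ht⟩⟩

theorem tendsto_apply (hT : StronglyContinuous T) {x : ℝ → E} {z : E} {t₀ : ℝ} {l : Filter ℝ}
    (hl : l ≤ 𝓝 t₀) (hx : Tendsto x l (𝓝 z)) :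
    Tendsto (fun t => T t (x t)) l (𝓝 (T t₀ z)) := by
  obtain ⟨M, hM⟩ := hT.exists_norm_le (|t₀| + 1)
  have hmem : Icc (-(|t₀| + 1)) (|t₀| + 1) ∈ l :=
    hl (Icc_mem_nhds (by linarith [neg_abs_le t₀]) (by linarith [le_abs_self t₀]))
  have hdiff : Tendsto (fun t => T t (x t - z)) l (𝓝 0) :=
    squeeze_zero_norm' (mem_of_superset hmem fun t ht => (T t).le_of_opNorm_le (hM t ht) _)
      (by simpa using (tendsto_iff_norm_sub_tendsto_zero.1 hx).const_mul M)
  simpa using hdiff.add (((hT z).tendsto t₀).mono_left hl)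

theorem continuous_apply (hT : StronglyContinuous T) {x : ℝ → E} (hx : Continuous x) :
    Continuous fun t => T t (x t) :=
  continuous_iff_continuousAt.2 fun t => hT.tendsto_apply le_rfl (hx.tendsto t)

theorem comp {D : Type*} [NormedAddCommGroup D] [NormedSpace 𝕜 D] {T' : ℝ → D →L[𝕜] E}
    (hT : StronglyContinuous T) (hT' : StronglyContinuous T') :
    StronglyContinuous fun t => (T t).comp (T' t) :=
  fun z => hT.continuous_apply (hT' z)

variable [NormedSpace ℝ F] [IsScalarTower ℝ 𝕜 F]

section Derivative

variable [NormedSpace ℝ E] [IsScalarTower ℝ 𝕜 E]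

theorem hasDerivAt_apply_sub (hT : StronglyContinuous T) {x : ℝ → E} {x' : E} {t₀ : ℝ}
    (hx : HasDerivAt x x' t₀) : HasDerivAt (fun t => T t (x t - x t₀)) (T t₀ x') t₀ := by
  rw [hasDerivAt_iff_tendsto_slope] at hx ⊢
  refine (hT.tendsto_apply nhdsWithin_le_nhds hx).congr fun t => ?_
  simp [slope_def_module, (T t).map_smul_of_tower]

theorem hasDerivAt_apply (hT : StronglyContinuous T) {x : ℝ → E} {x' : E} {w : F} {t₀ : ℝ}
    (hx : HasDerivAt x x' t₀) (hw : HasDerivAt (fun t => T t (x t₀)) w t₀) :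
    HasDerivAt (fun t => T t (x t)) (T t₀ x' + w) t₀ := by
  simpa [Pi.add_def] using (hT.hasDerivAt_apply_sub hx).add hw

end Derivative

/-- The strong integral `∫₀ᵗ T(s) ds` of a strongly continuous family, as a bounded operator. -/
def integral (hT : StronglyContinuous T) (t : ℝ) : E →L[𝕜] F :=
  LinearMap.mkContinuousOfExistsBound
    { toFun := fun z => ∫ s in (0)..t, T s z
      map_add' := fun z w => by
        simpa using intervalIntegral.integral_add ((hT z).intervalIntegrable _ _)
          ((hT w).intervalIntegrable _ _)
      map_smul' := fun c z => by simp }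
    ((hT.exists_norm_le |t|).imp' (· * |t|) fun _ hM => norm_integral_apply_le hM)

variable (hT : StronglyContinuous T)
include hT

theorem integral_zero_apply (z : E) : hT.integral 0 z = 0 := intervalIntegral.integral_same

theorem hasDerivAt_integral [CompleteSpace F] (z : E) (t : ℝ) :
    HasDerivAt (fun t => hT.integral t z) (T t z) t :=
  hasDerivAt_integral_right (hT z) 0 t

theorem stronglyContinuous_integral [CompleteSpace F] : StronglyContinuous hT.integral :=
  fun z => continuous_iff_continuousAt.2 fun t => (hT.hasDerivAt_integral z t).continuousAt

end StronglyContinuous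

end StronglyContinuous

/-! ### Strongly continuous groups -/

namespace IsC0Group

variable {𝕜 E : Type*} [RCLike 𝕜] [NormedAddCommGroup E] [NormedSpace 𝕜 E] {T : ℝ → E →L[𝕜] E}

theorem stronglyContinuous (hT : IsC0Group T) : StronglyContinuous T := hT.strongly_continuous

theorem apply_zero (hT : IsC0Group T) (z : E) : T 0 z = z := by simp [hT.map_zero]

theorem apply_add (hT : IsC0Group T) (s t : ℝ) (z : E) : T (s + t) z = T s (T t z) := by
  simp [hT.map_add]

theorem apply_apply_neg (hT : IsC0Group T) (t : ℝ) (z : E) : T t (T (-t) z) = z := by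
  rw [← hT.apply_add, add_neg_cancel, hT.apply_zero]

variable [NormedSpace ℝ E]

section Integral

variable [CompleteSpace E]

theorem apply_integral (hT : IsC0Group T) (z : E) (a t : ℝ) :
    T t (∫ s in (0)..a, T s z) = (∫ s in (0)..(a + t), T s z) - ∫ s in (0)..t, T s z := by
  have hint := (hT.stronglyContinuous z).intervalIntegrable (μ := MeasureTheory.volume)
  calc T t (∫ s in (0)..a, T s z) = ∫ s in (0)..a, T (s + t) z := by
        rw [← ContinuousLinearMap.intervalIntegral_comp_comm _ (hint _ _)]
        simp only [← hT.apply_add, add_comm t]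
    _ = (∫ s in (0)..(a + t), T s z) - ∫ s in (0)..t, T s z := by
        rw [intervalIntegral.integral_comp_add_right (fun s => T s z), zero_add,
          intervalIntegral.integral_interval_sub_left (hint _ _) (hint _ _)]

theorem hasDerivAt_apply_integral (hT : IsC0Group T) (z : E) (a : ℝ) :
    HasDerivAt (fun t => T t (∫ s in (0)..a, T s z)) (T a z - z) 0 := by
  have hc := hT.stronglyContinuous z
  have hshift : HasDerivAt (fun t => ∫ s in (0)..(a + t), T s z) (T a z) 0 :=
    HasDerivAt.comp_const_add a 0 (by simpa using hasDerivAt_integral_right hc 0 a)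
  simpa only [hT.apply_integral, hT.apply_zero] using! hshift.sub (hasDerivAt_integral_right hc 0 0)

end Integral

variable [IsScalarTower ℝ 𝕜 E]

theorem hasDerivAt (hT : IsC0Group T) {z w : E} (h : HasDerivAt (fun t => T t z) w 0) (t : ℝ) :
    HasDerivAt (fun s => T s z) (T t w) t := by
  have hshift : HasDerivAt (fun s => T (s - t) z) w t :=
    HasDerivAt.comp_sub_const t t (by simpa using h)
  simpa [← hT.apply_add] using hasDerivAt_clm_apply (T t) hshift

theorem hasDerivAt_apply_zero (hT : IsC0Group T) {z w : E}
    (h : HasDerivAt (fun t => T t z) w 0) (t : ℝ) :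
    HasDerivAt (fun s => T s (T t z)) (T t w) 0 := by
  simpa only [← hT.apply_add] using
    HasDerivAt.comp_add_const 0 t (by simpa using hT.hasDerivAt h t)

variable [CompleteSpace E]

theorem eq_of_hasDerivAt (hT : IsC0Group T) {u u' : ℝ → E} (hu : ∀ t, HasDerivAt u (u' t) t)
    (hgen : ∀ t, HasDerivAt (fun s => T s (u t)) (u' t) 0) (t : ℝ) : u t = T t (u 0) := by
  have hconst : (fun r => T (-r) (u r)) = fun _ => u 0 := by
    refine eq_of_hasDerivAt_eq (f' := 0) (t₀ := 0) (fun s => ?_)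
      (fun s => hasDerivAt_const s (u 0)) (by simp [hT.apply_zero])
    have hback : HasDerivAt (fun r => T (-r) (u s)) (-(T (-s) (u' s))) s := by
      simpa using! (hT.hasDerivAt (hgen s) (-s)).scomp s (hasDerivAt_neg s)
    simpa using hT.stronglyContinuous.comp_neg.hasDerivAt_apply (hu s) hback
  rw [← congrFun hconst t, hT.apply_apply_neg]

theorem hasDerivAt_zero_iff (hT : IsC0Group T) {z w : E} :
    HasDerivAt (fun t => T t z) w 0 ↔ ∀ t, T t z = z + hT.stronglyContinuous.integral t w := by
  refine ⟨fun h => congrFun (eq_of_hasDerivAt_eq (t₀ := 0) (hT.hasDerivAt h)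
    (fun t => (hT.stronglyContinuous.hasDerivAt_integral w t).const_add z)
    (by simp [hT.apply_zero, StronglyContinuous.integral_zero_apply])), fun h => ?_⟩
  simpa only [h, hT.apply_zero] using (hT.stronglyContinuous.hasDerivAt_integral w 0).const_add z

end IsC0Group

namespace GeneratesC0Group

variable {𝕜 E : Type*} [RCLike 𝕜] [NormedAddCommGroup E] [NormedSpace ℝ E] [NormedSpace 𝕜 E]
  [IsScalarTower ℝ 𝕜 E] [CompleteSpace E] {G : E →ₗ.[𝕜] E}

theorem isClosed (hG : GeneratesC0Group G) : G.IsClosed := by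
  obtain ⟨T, hT, hgen⟩ := hG
  have hgraph : (G.graph : Set (E × E)) =
      ⋂ t, {p : E × E | T t p.1 = p.1 + hT.stronglyContinuous.integral t p.2} := by
    ext p
    simp only [SetLike.mem_coe, mem_iInter, mem_ofPred_eq]
    exact (hgen p.1 p.2).trans hT.hasDerivAt_zero_iff
  rw [LinearPMap.IsClosed, hgraph]
  exact isClosed_iInter fun t => isClosed_eq (by fun_prop) (by fun_prop)

/-- The means `t⁻¹ ∫₀ᵗ T(s) z ds` lie in the domain and converge to `z`. -/
theorem dense_domain (hG : GeneratesC0Group G) : Dense (G.domain : Set E) := by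
  obtain ⟨T, hT, hgen⟩ := hG
  intro z
  have hlim := (hasDerivAt_iff_tendsto_slope.1
    (hasDerivAt_integral_right (hT.stronglyContinuous z) 0 0))
  rw [hT.apply_zero] at hlim
  refine mem_closure_of_tendsto hlim (Eventually.of_forall fun a => ?_)
  have hmem := LinearPMap.mem_domain_of_mem_graph
    ((hgen _ _).2 (hT.hasDerivAt_apply_integral z a))
  simpa [slope_def_module] using G.domain.smul_of_tower_mem a⁻¹ hmem

end GeneratesC0Group

namespace IsC0Group

variable {𝕜 E : Type*} [RCLike 𝕜] [NormedAddCommGroup E] [NormedSpace ℝ E] [NormedSpace 𝕜 E]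
  {T : ℝ → E →L[𝕜] E}

theorem hasDerivAt_rescale_iff (hT : IsC0Group T) {μ : ℝ} {z f : E} :
    HasDerivAt (fun t => Real.exp (-(μ * t)) • T t z) f 0 ↔
      HasDerivAt (fun t => T t z) (μ • z + f) 0 := by
  have hexp (c : ℝ) : HasDerivAt (fun t : ℝ => Real.exp (c * t)) c 0 := by
    simpa using ((hasDerivAt_id (0 : ℝ)).const_mul c).exp
  constructor <;> intro h
  · simpa [Pi.smul_def', hT.apply_zero, smul_smul, ← Real.exp_add, add_comm] using
      (hexp μ).smul h
  · simpa [Pi.smul_def', hT.apply_zero] using (hexp (-μ)).smul h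

variable [IsScalarTower ℝ 𝕜 E]

theorem rescale (hT : IsC0Group T) (μ : ℝ) : IsC0Group fun t => Real.exp (-(μ * t)) • T t where
  map_zero := by simp [hT.map_zero]
  map_add s t := by
    ext z
    simp [hT.apply_add, smul_smul, ← Real.exp_add, mul_add, add_comm]
  strongly_continuous z :=
    (by fun_prop : Continuous fun t : ℝ => Real.exp (-(μ * t))).smul (hT.strongly_continuous z)

variable [CompleteSpace E]

theorem existsUnique_hasDerivAt (hT : IsC0Group T) {a : ℝ} (ha : ‖T a‖ < 1) (f : E) :
    ∃! z, HasDerivAt (fun t => T t z) f 0 := by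
  have hbij : Function.Bijective fun z => z - T a z := by
    simpa using! ContinuousLinearMap.isUnit_iff_bijective.1 (isUnit_one_sub_of_norm_lt_one ha)
  obtain ⟨g, hg⟩ := hbij.surjective (-f)
  have hg' : T a g - g = f := by rw [← neg_sub, show g - T a g = -f from hg, neg_neg]
  refine ⟨∫ s in (0)..a, T s g, hg' ▸ hT.hasDerivAt_apply_integral g a, fun z hz => ?_⟩
  have hz' := hT.hasDerivAt_zero_iff.1 hz a
  have hg'' := hT.hasDerivAt_zero_iff.1 (hg' ▸ hT.hasDerivAt_apply_integral g a) a
  exact hbij.injective (by simp only [hz', hg'', sub_add_cancel_left])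

theorem exists_resolvent (hT : IsC0Group T) :
    ∃ μ : ℝ, ∀ f, ∃! z, HasDerivAt (fun t => T t z) (μ • z + f) 0 := by
  have hpos : 0 < ‖T 1‖ + 1 := by positivity
  have hnorm : ‖Real.exp (-(Real.log (‖T 1‖ + 1) * 1)) • T 1‖ < 1 := by
    rw [norm_smul, mul_one, Real.exp_neg, Real.exp_log hpos, Real.norm_of_nonneg (by positivity),
      inv_mul_lt_one₀ hpos]
    exact lt_add_one _
  refine ⟨Real.log (‖T 1‖ + 1), fun f => ?_⟩
  simpa [hT.hasDerivAt_rescale_iff] using! (hT.rescale _).existsUnique_hasDerivAt hnorm f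

end IsC0Group

/-! ### Bounded perturbations of groups -/

section Evolution

variable {𝕜 E : Type*} [RCLike 𝕜] [NormedAddCommGroup E] [NormedSpace ℝ E] [NormedSpace 𝕜 E]
  [CompleteSpace E] {b : ℝ → E →L[𝕜] E}

theorem eq_of_hasDerivAt_evolution (hb : StronglyContinuous b) {v w : ℝ → E}
    (hv : ∀ t, HasDerivAt v (b t (v t)) t) (hw : ∀ t, HasDerivAt w (b t (w t)) t)
    (h₀ : v 0 = w 0) : v = w := by
  ext t
  obtain ⟨M, hM⟩ := hb.exists_norm_le (|t| + 1)
  have hlip : ∀ s ∈ Ioo (-(|t| + 1)) (|t| + 1), LipschitzOnWith M.toNNReal (b s) univ := by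
    refine fun s hs => ((b s).lipschitz.weaken ?_).lipschitzOnWith
    rw [← norm_toNNReal]
    exact Real.toNNReal_le_toNNReal (hM s (Ioo_subset_Icc_self hs))
  exact ODE_solution_unique_of_mem_Ioo (v := fun s x => b s x) hlip
    (abs_lt.1 (by simpa using (by positivity : 0 < |t| + 1)))
    (fun s _ => ⟨hv s, mem_univ _⟩) (fun s _ => ⟨hw s, mem_univ _⟩) h₀
    (abs_lt.1 (lt_add_one |t|))

variable [IsScalarTower ℝ 𝕜 E]

/-- The summands of the Dyson series `V₀ = 1`, `Vₙ₊₁(t) = ∫₀ᵗ b(s) Vₙ(s) ds` that solves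
`v' = b(t) v`; strong continuity is carried along since the integral operator needs it. -/
def dysonTerm (hb : StronglyContinuous b) : ℕ → {V : ℝ → E →L[𝕜] E // StronglyContinuous V}
  | 0 => ⟨fun _ => .id 𝕜 E, fun _ => continuous_const⟩
  | n + 1 =>
    have h := hb.comp (dysonTerm hb n).2
    ⟨h.integral, h.stronglyContinuous_integral⟩

theorem hasDerivAt_dysonTerm_succ (hb : StronglyContinuous b) (n : ℕ) (z : E) (t : ℝ) :
    HasDerivAt (fun t => (dysonTerm hb (n + 1)).1 t z) (b t ((dysonTerm hb n).1 t z)) t :=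
  (hb.comp (dysonTerm hb n).2).hasDerivAt_integral z t

theorem norm_dysonTerm_le (hb : StronglyContinuous b) {a M : ℝ} (hM : ∀ t ∈ Icc (-a) a, ‖b t‖ ≤ M)
    (n : ℕ) {t : ℝ} (ht : t ∈ Icc (-a) a) :
    ‖(dysonTerm hb n).1 t‖ ≤ (M * |t|) ^ n / n.factorial := by
  have hM₀ : 0 ≤ M := (norm_nonneg _).trans (hM t ht)
  induction n generalizing t with
  | zero => simpa [dysonTerm] using ContinuousLinearMap.norm_id_le
  | succ n ih =>
    refine ContinuousLinearMap.opNorm_le_bound _ (by positivity) fun z => ?_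
    have hpt : ∀ s ∈ uIoc 0 t,
        ‖b s ((dysonTerm hb n).1 s z)‖ ≤ M ^ (n + 1) / n.factorial * ‖z‖ * |s - 0| ^ n := by
      intro s hs
      have hs' : s ∈ Icc (-a) a := uIcc_subset_Icc
        ⟨by linarith [ht.1, ht.2], by linarith [ht.1, ht.2]⟩ ht (uIoc_subset_uIcc hs)
      calc ‖b s ((dysonTerm hb n).1 s z)‖ ≤ M * ((M * |s|) ^ n / n.factorial * ‖z‖) :=
            (b s).le_of_opNorm_le_of_le (hM s hs')
              (((dysonTerm hb n).1 s).le_of_opNorm_le (ih hs') z)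
        _ = M ^ (n + 1) / n.factorial * ‖z‖ * |s - 0| ^ n := by rw [sub_zero]; ring
    calc ‖(dysonTerm hb (n + 1)).1 t z‖
        ≤ ∫ s in uIoc 0 t, ‖b s ((dysonTerm hb n).1 s z)‖ :=
          intervalIntegral.norm_integral_le_integral_norm_uIoc
      _ ≤ ∫ s in uIoc 0 t, M ^ (n + 1) / n.factorial * ‖z‖ * |s - 0| ^ n :=
          MeasureTheory.setIntegral_mono_on
            ((hb.comp (dysonTerm hb n).2 z).norm.integrableOn_uIoc)
            ((by fun_prop : Continuous fun s : ℝ => M ^ (n + 1) / n.factorial * ‖z‖ * |s - 0| ^ n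
              ).integrableOn_uIoc) measurableSet_uIoc hpt
      _ = (M * |t|) ^ (n + 1) / (n + 1).factorial * ‖z‖ := by
          rw [MeasureTheory.integral_const_mul, integral_pow_abs_sub_uIoc, sub_zero,
            Nat.factorial_succ, Nat.cast_mul, Nat.cast_succ, mul_pow]
          field_simp

theorem summable_dysonTerm (hb : StronglyContinuous b) (t : ℝ) :
    Summable fun n => (dysonTerm hb n).1 t := by
  obtain ⟨M, hM⟩ := hb.exists_norm_le |t|
  exact .of_norm_bounded (Real.summable_pow_div_factorial (M * |t|)) fun n =>
    norm_dysonTerm_le hb hM n ⟨neg_abs_le t, le_abs_self t⟩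

/-- The solution operators `v 0 ↦ v t` of `v' = b(t) v`, as the sum of the Dyson series. -/
def evolution (hb : StronglyContinuous b) (t : ℝ) : E →L[𝕜] E := ∑' n, (dysonTerm hb n).1 t

theorem hasSum_evolution_apply (hb : StronglyContinuous b) (t : ℝ) (z : E) :
    HasSum (fun n => (dysonTerm hb n).1 t z) (evolution hb t z) :=
  (ContinuousLinearMap.apply 𝕜 E z).hasSum (summable_dysonTerm hb t).hasSum

theorem evolution_apply (hb : StronglyContinuous b) (t : ℝ) (z : E) :
    evolution hb t z = z + ∑' n, (dysonTerm hb (n + 1)).1 t z := by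
  have hsum := hasSum_evolution_apply hb t z
  rw [← hsum.tsum_eq, hsum.summable.tsum_eq_zero_add]
  rfl

theorem evolution_zero_apply (hb : StronglyContinuous b) (z : E) : evolution hb 0 z = z := by
  have hsucc (n : ℕ) : (dysonTerm hb (n + 1)).1 0 z = 0 :=
    (hb.comp (dysonTerm hb n).2).integral_zero_apply z
  simp [evolution_apply, hsucc]

theorem hasDerivAt_evolution (hb : StronglyContinuous b) (z : E) (t : ℝ) :
    HasDerivAt (fun t => evolution hb t z) (b t (evolution hb t z)) t := by
  set a := |t| + 1
  obtain ⟨M, hM⟩ := hb.exists_norm_le a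
  have hmem : t ∈ Ioo (-a) a := abs_lt.1 (lt_add_one |t|)
  have hbound (n : ℕ) (s : ℝ) (hs : s ∈ Ioo (-a) a) :
      ‖b s ((dysonTerm hb n).1 s z)‖ ≤ M * ((M * a) ^ n / n.factorial * ‖z‖) := by
    have hs' := Ioo_subset_Icc_self hs
    have hM₀ : 0 ≤ M := (norm_nonneg _).trans (hM s hs')
    have hsa : |s| ≤ a := abs_le.2 hs'
    refine (b s).le_of_opNorm_le_of_le (hM s hs') (((dysonTerm hb n).1 s).le_of_opNorm_le ?_ z)
    exact (norm_dysonTerm_le hb hM n hs').trans (by gcongr)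
  have hsum (s : ℝ) := (hasSum_evolution_apply hb s z).summable
  have hderiv := hasDerivAt_tsum_of_isPreconnected
    (((Real.summable_pow_div_factorial (M * a)).mul_right ‖z‖).mul_left M) isOpen_Ioo
    isPreconnected_Ioo (fun n s _ => hasDerivAt_dysonTerm_succ hb n z s) hbound hmem
    ((summable_nat_add_iff 1).2 (hsum t)) hmem
  rw [← (b t).map_tsum (hsum t), (hasSum_evolution_apply hb t z).tsum_eq] at hderiv
  simpa only [evolution_apply] using hderiv.const_add z

theorem stronglyContinuous_evolution (hb : StronglyContinuous b) :
    StronglyContinuous (evolution hb) :=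
  fun z => continuous_iff_continuousAt.2 fun t => (hasDerivAt_evolution hb z t).continuousAt

end Evolution

namespace IsC0Group

variable {𝕜 E : Type*} [RCLike 𝕜] [NormedAddCommGroup E] [NormedSpace 𝕜 E] [CompleteSpace E]
  {U : ℝ → E →L[𝕜] E}

theorem stronglyContinuous_conj (hU : IsC0Group U) (B : E →L[𝕜] E) :
    StronglyContinuous fun t => (U (-t)).comp (B.comp (U t)) :=
  hU.stronglyContinuous.comp_neg.comp fun z => B.continuous.comp (hU.strongly_continuous z)

variable [NormedSpace ℝ E] [IsScalarTower ℝ 𝕜 E]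

/-- In the interaction picture the perturbed group is `U(t) W(t)`, where `W` solves
`W' = U(-t) B U(t) W`. -/
theorem perturbation (hU : IsC0Group U) (B : E →L[𝕜] E) :
    IsC0Group fun t => (U t).comp (evolution (hU.stronglyContinuous_conj B) t) where
  map_zero := by ext z; simp [evolution_zero_apply, hU.apply_zero]
  map_add s t := by
    set hb := hU.stronglyContinuous_conj B
    ext z
    have hshift : (fun r => U t (evolution hb (r + t) z)) =
        fun r => evolution hb r (U t (evolution hb t z)) := by
      refine eq_of_hasDerivAt_evolution hb (fun r => ?_) (fun r => hasDerivAt_evolution hb _ r)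
        (by simp [evolution_zero_apply])
      refine (hasDerivAt_clm_apply (U t)
        ((hasDerivAt_evolution hb z (r + t)).comp_add_const r t)).congr_deriv ?_
      simp only [ContinuousLinearMap.comp_apply, ← hU.apply_add]
      rw [show t + -(r + t) = -r by ring]
    simpa [hU.apply_add] using congrArg (U s) (congrFun hshift s)
  strongly_continuous := hU.stronglyContinuous.comp (stronglyContinuous_evolution _)

theorem hasDerivAt_perturbation_iff (hU : IsC0Group U) (B : E →L[𝕜] E) {z w : E} :
    HasDerivAt (fun t => U t (evolution (hU.stronglyContinuous_conj B) t z)) w 0 ↔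
      HasDerivAt (fun t => U t z) (w - B z) 0 := by
  set hb := hU.stronglyContinuous_conj B
  have hdiff : HasDerivAt (fun t => U t (evolution hb t z - z)) (B z) 0 := by
    simpa [evolution_zero_apply, hU.apply_zero] using
      hU.stronglyContinuous.hasDerivAt_apply_sub (hasDerivAt_evolution hb z 0)
  constructor <;> intro h
  · simpa [Pi.sub_def] using h.sub hdiff
  · simpa [Pi.add_def] using h.add hdiff

end IsC0Group

/-! ### Cosine operator functions -/

section Calculus

variable {X : Type*} [NormedAddCommGroup X] [NormedSpace ℝ X]

theorem tendsto_two_div_sq_smul {φ ψ : ℝ → X} {a : X} (hφ : ∀ t, HasDerivAt φ (ψ t) t)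
    (hφ₀ : φ 0 = 0) (hψ₀ : ψ 0 = 0) (hψ : HasDerivAt ψ a 0) :
    Tendsto (fun t : ℝ => (2 / t ^ 2) • φ t) (𝓝[≠] 0) (𝓝 a) := by
  have hderiv (t : ℝ) : HasDerivAt (fun s => φ s - (s ^ 2 / 2) • a) (ψ t - t • a) t := by
    refine (hφ t).sub (HasDerivAt.smul_const ?_ a)
    simpa using (hasDerivAt_pow 2 t).div_const 2
  have hlittle : (fun t => φ t - (t ^ 2 / 2) • a) =o[𝓝 0] fun t : ℝ => t ^ 2 := by
    have := convex_univ.isLittleO_pow_succ_real (x₀ := 0) (n := 1) (mem_univ _)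
      (fun t _ => (hderiv t).hasDerivWithinAt) (by simpa [hψ₀] using hψ.isLittleO)
    simpa [hφ₀] using this
  have hquot := (hlittle.mono (nhdsWithin_le_nhds (s := {0}ᶜ))).tendsto_inv_smul_nhds_zero
  have hlim := (hquot.const_smul (2 : ℝ)).add_const a
  rw [smul_zero, zero_add] at hlim
  refine hlim.congr' (eventually_mem_nhdsWithin.mono fun t ht => ?_)
  have ht' : t ≠ 0 := ht
  rw [smul_smul, smul_sub, smul_smul, ← div_eq_mul_inv,
    div_mul_div_cancel₀ (pow_ne_zero 2 ht'), div_self two_ne_zero, one_smul, sub_add_cancel]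

theorem hasDerivAt_half_add_shift {f f' : ℝ → X} (hf : ∀ t, HasDerivAt f (f' t) t) (τ t : ℝ) :
    HasDerivAt (fun t => (1 / 2 : ℝ) • (f (t + τ) + f (t - τ)))
      ((1 / 2 : ℝ) • (f' (t + τ) + f' (t - τ))) t :=
  (((hf _).comp_add_const t τ).add ((hf _).comp_sub_const t τ)).const_smul _

theorem eq_half_add_shift {f f' g g' : ℝ → X} {τ : ℝ} (hf : ∀ t, HasDerivAt f (f' t) t)
    (hg : ∀ t, HasDerivAt g (g' t) t) (h' : ∀ t, f' t = (1 / 2 : ℝ) • (g' (t + τ) + g' (t - τ)))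
    (h₀ : f 0 = (1 / 2 : ℝ) • (g τ + g (-τ))) (t : ℝ) :
    f t = (1 / 2 : ℝ) • (g (t + τ) + g (t - τ)) :=
  congrFun (eq_of_hasDerivAt_eq (t₀ := 0) (fun t => h' t ▸ hf t) (hasDerivAt_half_add_shift hg τ)
    (by simpa using h₀)) t

theorem hasDerivAt_comp_neg {f : ℝ → X} {f' : X} {t : ℝ} (hf : HasDerivAt f f' (-t)) :
    HasDerivAt (fun s => f (-s)) (-f') t := by
  simpa using! hf.scomp t (hasDerivAt_neg t)

end Calculus

namespace IsCosineFunction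

variable {𝕜 X : Type*} [RCLike 𝕜] [NormedAddCommGroup X] [NormedSpace ℝ X] [NormedSpace 𝕜 X]
  {C : ℝ → X →L[𝕜] X}

theorem stronglyContinuous (hC : IsCosineFunction C) : StronglyContinuous C :=
  hC.strongly_continuous

theorem apply_zero (hC : IsCosineFunction C) (z : X) : C 0 z = z := by simp [hC.map_zero]

theorem apply_neg (hC : IsCosineFunction C) (t : ℝ) (z : X) : C (-t) z = C t z := by
  simpa [hC.apply_zero, two_smul] using hC.dAlembert t 0 z

theorem apply_apply (hC : IsCosineFunction C) (t τ : ℝ) (z : X) :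
    C t (C τ z) = (1 / 2 : ℝ) • (C (t + τ) z + C (t - τ) z) := by
  rw [hC.dAlembert, smul_smul, one_div_mul_cancel two_ne_zero, one_smul]

theorem apply_apply' (hC : IsCosineFunction C) (t τ : ℝ) (z : X) :
    C τ (C t z) = (1 / 2 : ℝ) • (C (t + τ) z + C (t - τ) z) := by
  rw [hC.apply_apply, add_comm τ t, ← hC.apply_neg (τ - t), neg_sub]

variable [CompleteSpace X] [IsScalarTower ℝ 𝕜 X]

/-- The sine function `S(t) = ∫₀ᵗ C(s) ds` associated with a cosine function. -/
def sine (hC : IsCosineFunction C) : ℝ → X →L[𝕜] X := hC.stronglyContinuous.integral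

theorem stronglyContinuous_sine (hC : IsCosineFunction C) : StronglyContinuous hC.sine :=
  hC.stronglyContinuous.stronglyContinuous_integral

theorem sine_zero_apply (hC : IsCosineFunction C) (z : X) : hC.sine 0 z = 0 :=
  hC.stronglyContinuous.integral_zero_apply z

theorem hasDerivAt_sine (hC : IsCosineFunction C) (z : X) (t : ℝ) :
    HasDerivAt (fun t => hC.sine t z) (C t z) t :=
  hC.stronglyContinuous.hasDerivAt_integral z t

theorem sine_neg_apply (hC : IsCosineFunction C) (t : ℝ) (z : X) :
    hC.sine (-t) z = -hC.sine t z :=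
  congrFun (eq_of_hasDerivAt_eq (f := fun t => hC.sine (-t) z) (g := fun t => -hC.sine t z)
    (fun t => by simpa [hC.apply_neg] using hasDerivAt_comp_neg (hC.hasDerivAt_sine z (-t)))
    (fun t => (hC.hasDerivAt_sine z t).neg) (t₀ := 0) (by simp [hC.sine_zero_apply])) t

theorem sine_apply (hC : IsCosineFunction C) (τ t : ℝ) (z : X) :
    hC.sine t (C τ z) = (1 / 2 : ℝ) • (hC.sine (t + τ) z + hC.sine (t - τ) z) :=
  eq_half_add_shift (hC.hasDerivAt_sine (C τ z)) (hC.hasDerivAt_sine z)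
    (fun t => hC.apply_apply t τ z) (by simp [hC.sine_zero_apply, hC.sine_neg_apply]) t

theorem apply_sine (hC : IsCosineFunction C) (τ t : ℝ) (z : X) :
    C τ (hC.sine t z) = (1 / 2 : ℝ) • (hC.sine (t + τ) z + hC.sine (t - τ) z) :=
  eq_half_add_shift (fun t => hasDerivAt_clm_apply (C τ) (hC.hasDerivAt_sine z t))
    (hC.hasDerivAt_sine z) (fun t => hC.apply_apply' t τ z)
    (by simp [hC.sine_zero_apply, hC.sine_neg_apply]) t

/-- The integral `∫₀ᵗ S(s) ds` of the sine function associated with a cosine function. -/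
def sineIntegral (hC : IsCosineFunction C) : ℝ → X →L[𝕜] X := hC.stronglyContinuous_sine.integral

theorem sineIntegral_zero_apply (hC : IsCosineFunction C) (z : X) : hC.sineIntegral 0 z = 0 :=
  hC.stronglyContinuous_sine.integral_zero_apply z

theorem hasDerivAt_sineIntegral (hC : IsCosineFunction C) (z : X) (t : ℝ) :
    HasDerivAt (fun t => hC.sineIntegral t z) (hC.sine t z) t :=
  hC.stronglyContinuous_sine.hasDerivAt_integral z t

theorem sineIntegral_neg_apply (hC : IsCosineFunction C) (t : ℝ) (z : X) :
    hC.sineIntegral (-t) z = hC.sineIntegral t z :=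
  congrFun (eq_of_hasDerivAt_eq (f := fun t => hC.sineIntegral (-t) z)
    (fun t => by
      simpa [hC.sine_neg_apply] using hasDerivAt_comp_neg (hC.hasDerivAt_sineIntegral z (-t)))
    (hC.hasDerivAt_sineIntegral z) (t₀ := 0) (by simp)) t

theorem sineIntegral_apply_add (hC : IsCosineFunction C) (τ t : ℝ) (z : X) :
    hC.sineIntegral t (C τ z) + hC.sineIntegral τ z =
      (1 / 2 : ℝ) • (hC.sineIntegral (t + τ) z + hC.sineIntegral (t - τ) z) := by
  refine eq_half_add_shift (fun t => (hC.hasDerivAt_sineIntegral (C τ z) t).add_const _)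
    (hC.hasDerivAt_sineIntegral z) (fun t => hC.sine_apply τ t z) ?_ t
  rw [hC.sineIntegral_zero_apply, hC.sineIntegral_neg_apply]
  module

theorem sineIntegral_apply_sub_comm (hC : IsCosineFunction C) (τ t : ℝ) (z : X) :
    hC.sineIntegral t (C τ z - z) = hC.sineIntegral τ (C t z - z) := by
  have hsymm := hC.sineIntegral_apply_add τ t z
  rw [add_comm t τ, ← hC.sineIntegral_neg_apply (t - τ), neg_sub,
    ← hC.sineIntegral_apply_add t τ z] at hsymm
  rw [map_sub, map_sub, sub_eq_sub_iff_add_eq_add, hsymm]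

theorem apply_eq_add_sineIntegral (hC : IsCosineFunction C) {z w : X}
    (h : Tendsto (fun t : ℝ => (2 / t ^ 2) • (C t z - z)) (𝓝[≠] 0) (𝓝 w)) (t : ℝ) :
    C t z = z + hC.sineIntegral t w := by
  have hleft : Tendsto (fun τ : ℝ => hC.sineIntegral t ((2 / τ ^ 2) • (C τ z - z))) (𝓝[≠] 0)
      (𝓝 (hC.sineIntegral t w)) := ((hC.sineIntegral t).continuous.tendsto w).comp h
  have hright : Tendsto (fun τ : ℝ => (2 / τ ^ 2) • hC.sineIntegral τ (C t z - z)) (𝓝[≠] 0)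
      (𝓝 (C t z - z)) :=
    tendsto_two_div_sq_smul (hC.hasDerivAt_sineIntegral _) (hC.sineIntegral_zero_apply _)
      (hC.sine_zero_apply _) (by simpa [hC.apply_zero] using hC.hasDerivAt_sine (C t z - z) 0)
  simp only [(hC.sineIntegral t).map_smul_of_tower, hC.sineIntegral_apply_sub_comm _ t] at hleft
  rw [tendsto_nhds_unique hleft hright, add_sub_cancel]

end IsCosineFunction

/-! ### The group on the phase space -/

section Lift

variable {𝕜 X Y Z : Type*} [RCLike 𝕜]
  [NormedAddCommGroup X] [NormedSpace 𝕜 X]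
  [NormedAddCommGroup Y] [NormedSpace 𝕜 Y] [CompleteSpace Y]
  [NormedAddCommGroup Z] [NormedSpace 𝕜 Z] [CompleteSpace Z]
  {ι : Y →L[𝕜] X} (hι : Function.Injective ι) (Φ : Z →L[𝕜] X) (hΦ : ∀ z, Φ z ∈ range ι)

/-- The factorization through an injective bounded operator `ι` of a bounded operator with values
in the range of `ι`; it is bounded by the closed graph theorem. -/
def liftOfInjective : Z →L[𝕜] Y :=
  .ofIsClosedGraph (g := (LinearEquiv.ofInjective ι.toLinearMap hι).symm.toLinearMap ∘ₗ
      Φ.toLinearMap.codRestrict (LinearMap.range ι.toLinearMap) hΦ) <| by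
    convert isClosed_eq (ι.continuous.comp continuous_snd) (Φ.continuous.comp continuous_fst)
    ext ⟨z, y⟩
    simp only [SetLike.mem_coe, LinearMap.mem_graph_iff, LinearMap.comp_apply,
      LinearEquiv.coe_coe, LinearEquiv.eq_symm_apply, Subtype.ext_iff]
    rfl

theorem apply_liftOfInjective (z : Z) : ι (liftOfInjective hι Φ hΦ z) = Φ z :=
  LinearEquiv.ofInjective_symm_apply (f := ι.toLinearMap) (h := hι) ⟨Φ z, hΦ z⟩

end Lift

section StrongDeriv

variable {𝕜 E F : Type*} [RCLike 𝕜]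
  [NormedAddCommGroup E] [NormedSpace 𝕜 E] [CompleteSpace E]
  [NormedAddCommGroup F] [NormedSpace ℝ F] [NormedSpace 𝕜 F] [IsScalarTower ℝ 𝕜 F]

/-- The derivative in the strong operator topology of a family of bounded operators; it is bounded
by the uniform boundedness principle. -/
def strongDeriv (T : ℝ → E →L[𝕜] F) (hT : ∀ z, Differentiable ℝ fun t => T t z) (t : ℝ) :
    E →L[𝕜] F :=
  continuousLinearMapOfTendsto (fun r : ℝ => r⁻¹ • (T (t + r) - T t)) (l := 𝓝[≠] 0)
    (f := fun z => deriv (fun t => T t z) t)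
    (tendsto_pi_nhds.2 fun z => hasDerivAt_iff_tendsto_slope_zero.1 (hT z t).hasDerivAt)

theorem hasDerivAt_strongDeriv (T : ℝ → E →L[𝕜] F) (hT : ∀ z, Differentiable ℝ fun t => T t z)
    (t : ℝ) (z : E) : HasDerivAt (fun t => T t z) (strongDeriv T hT t z) t :=
  (hT z t).hasDerivAt

theorem hasDerivAt_of_injective_clm [NormedSpace ℝ E] [IsScalarTower ℝ 𝕜 E] {ι : E →L[𝕜] F}
    (hι : Function.Injective ι) {f g : ℝ → E} (hg : Continuous g)
    (h : ∀ t, HasDerivAt (fun t => ι (f t)) (ι (g t)) t) (t : ℝ) : HasDerivAt f (g t) t := by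
  have hint (t : ℝ) : HasDerivAt (fun t => f 0 + ∫ s in (0)..t, g s) (g t) t :=
    (hasDerivAt_integral_right hg 0 t).const_add _
  have heq := congrFun (eq_of_hasDerivAt_eq (t₀ := 0) h
    (fun t => hasDerivAt_clm_apply ι (hint t)) (by simp))
  simpa only [← hι (heq _)] using hint t

end StrongDeriv

namespace IsPhaseSpace

variable {𝕜 X Y : Type*} [RCLike 𝕜]
  [NormedAddCommGroup X] [NormedSpace ℝ X] [NormedSpace 𝕜 X]
  [NormedAddCommGroup Y] [NormedSpace 𝕜 Y]
  {C : ℝ → X →L[𝕜] X} {ι : Y →L[𝕜] X}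

theorem contDiff (hP : IsPhaseSpace C ι) (v : Y) : ContDiff ℝ 1 fun t => C t (ι v) :=
  (hP.1 _).1 (mem_range_self v)

theorem mem_range_of_hasDerivAt (hP : IsPhaseSpace C ι) {z : X} {f' : ℝ → X}
    (h : ∀ t, HasDerivAt (fun t => C t z) (f' t) t) (hcont : Continuous f') : z ∈ range ι :=
  (hP.1 z).2 (contDiff_one_of_hasDerivAt h hcont)

/-- On bounded time intervals the curves `τ ↦ ∂_τ C(τ) w(t)` depend continuously on `t` in the
supremum norm, which is the second summand of the norm of `Y`. -/
theorem continuous_of_continuous_deriv (hP : IsPhaseSpace C ι) {w : ℝ → Y} {D : ℝ → ℝ → X}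
    (hD : ∀ t τ, HasDerivAt (fun s => C s (ι (w t))) (D t τ) τ)
    (hDc : Continuous (Function.uncurry D)) (hw : Continuous fun t => ι (w t)) :
    Continuous w := by
  obtain ⟨-, c, K, hc, hnorm⟩ := hP
  let g (t : ℝ) : C(Icc (0 : ℝ) 1, X) :=
    ⟨fun τ => D t τ, hDc.comp (by fun_prop : Continuous fun τ : Icc (0 : ℝ) 1 => (t, (τ : ℝ)))⟩
  have hg : Continuous g := ContinuousMap.continuous_of_continuous_uncurry _ <|
    hDc.comp (by fun_prop : Continuous fun p : ℝ × Icc (0 : ℝ) 1 => (p.1, (p.2 : ℝ)))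
  have hsup (t t₀ : ℝ) :
      ⨆ τ : Icc (0 : ℝ) 1, ‖deriv (fun s => C s (ι (w t - w t₀))) τ‖ ≤ ‖g t - g t₀‖ := by
    refine ciSup_le fun τ => ?_
    have hτ : HasDerivAt (fun s => C s (ι (w t - w t₀))) ((g t - g t₀) τ) τ := by
      simpa using! (hD t τ).sub (hD t₀ τ)
    exact hτ.deriv ▸ (g t - g t₀).norm_coe_le_norm τ
  have hle (t t₀ : ℝ) : ‖w t - w t₀‖ ≤ c⁻¹ * (‖ι (w t) - ι (w t₀)‖ + ‖g t - g t₀‖) := by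
    rw [le_inv_mul_iff₀ hc, ← map_sub]
    exact (hnorm _).1.trans (add_le_add_right (hsup t t₀) _)
  refine continuous_iff_continuousAt.2 fun t₀ => tendsto_iff_norm_sub_tendsto_zero.2 <|
    squeeze_zero (fun _ => norm_nonneg _) (fun t => hle t t₀) ?_
  simpa using ((tendsto_iff_norm_sub_tendsto_zero.1 (hw.tendsto t₀)).add
    (tendsto_iff_norm_sub_tendsto_zero.1 (hg.tendsto t₀))).const_mul c⁻¹

variable [IsScalarTower ℝ 𝕜 X] [CompleteSpace Y]

/-- The derivative `C'(t)` of the cosine function, as a bounded operator from `Y` to `X`. -/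
def cosineDeriv (hP : IsPhaseSpace C ι) : ℝ → Y →L[𝕜] X :=
  strongDeriv (fun t => (C t).comp ι) fun v => (hP.contDiff v).differentiable one_ne_zero

theorem hasDerivAt_cosineDeriv (hP : IsPhaseSpace C ι) (v : Y) (t : ℝ) :
    HasDerivAt (fun t => C t (ι v)) (hP.cosineDeriv t v) t :=
  hasDerivAt_strongDeriv (fun t => (C t).comp ι) _ t v

theorem stronglyContinuous_cosineDeriv (hP : IsPhaseSpace C ι) :
    StronglyContinuous hP.cosineDeriv :=
  fun v => (hP.contDiff v).continuous_deriv le_rfl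

theorem cosineDeriv_zero_apply (hP : IsPhaseSpace C ι) (hC : IsCosineFunction C) (v : Y) :
    hP.cosineDeriv 0 v = 0 := by
  have hneg := hasDerivAt_comp_neg (t := 0) (by simpa using hP.hasDerivAt_cosineDeriv v 0)
  simp only [hC.apply_neg] at hneg
  have hsum := add_eq_zero_iff_eq_neg.2 ((hP.hasDerivAt_cosineDeriv v 0).unique hneg)
  exact (smul_eq_zero.1 ((two_smul ℝ _).trans hsum)).resolve_left two_ne_zero

/-- The derivative `C'(t) y + C(t) x` of the mild solution of the abstract wave equation with
initial data `(y, x)`. -/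
def velocity (hP : IsPhaseSpace C ι) (t : ℝ) : Y × X →L[𝕜] X := (hP.cosineDeriv t).coprod (C t)

theorem stronglyContinuous_velocity (hP : IsPhaseSpace C ι) (hC : IsCosineFunction C) :
    StronglyContinuous hP.velocity :=
  fun p => (hP.stronglyContinuous_cosineDeriv p.1).add (hC.strongly_continuous p.2)

theorem velocity_zero_apply (hP : IsPhaseSpace C ι) (hC : IsCosineFunction C) (p : Y × X) :
    hP.velocity 0 p = p.2 := by
  simp [velocity, hP.cosineDeriv_zero_apply hC, hC.apply_zero]

theorem mem_graph_of_hasDerivAt_velocity (hP : IsPhaseSpace C ι) (hC : IsCosineFunction C)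
    {G : X →ₗ.[𝕜] X} (hG : IsCosineGenerator C G) {p : Y × X} {y : Y} {x : X} (hy : ι y = p.2)
    (h : HasDerivAt (fun t => hP.velocity t p) x 0) : (ι p.1, x) ∈ G.graph := by
  have hderiv : HasDerivAt (fun t => hP.cosineDeriv t p.1) x 0 := by
    simpa [velocity, hy, Pi.sub_def, hP.cosineDeriv_zero_apply hC] using
      h.sub (hP.hasDerivAt_cosineDeriv y 0)
  exact (hG _ _).2 <| tendsto_two_div_sq_smul
    (fun t => (hP.hasDerivAt_cosineDeriv p.1 t).sub_const (ι p.1)) (by simp [hC.apply_zero])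
    (hP.cosineDeriv_zero_apply hC p.1) hderiv

end IsPhaseSpace

namespace IsCosineFunction

variable {𝕜 X Y : Type*} [RCLike 𝕜]
  [NormedAddCommGroup X] [NormedSpace ℝ X] [NormedSpace 𝕜 X] [IsScalarTower ℝ 𝕜 X] [CompleteSpace X]
  [NormedAddCommGroup Y] [NormedSpace 𝕜 Y]
  {C : ℝ → X →L[𝕜] X} {ι : Y →L[𝕜] X}

/-- The mild solution `C(t) y + S(t) x` of the abstract wave equation with initial data
`(y, x)`. -/
def trajectory (hC : IsCosineFunction C) (ι : Y →L[𝕜] X) (t : ℝ) : Y × X →L[𝕜] X :=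
  ((C t).comp ι).coprod (hC.sine t)

theorem trajectory_zero_apply (hC : IsCosineFunction C) (p : Y × X) :
    hC.trajectory ι 0 p = ι p.1 := by
  simp [trajectory, hC.apply_zero, hC.sine_zero_apply]

theorem apply_trajectory (hC : IsCosineFunction C) (t τ : ℝ) (p : Y × X) :
    C τ (hC.trajectory ι t p) =
      (1 / 2 : ℝ) • (hC.trajectory ι (t + τ) p + hC.trajectory ι (t - τ) p) := by
  simp only [trajectory, ContinuousLinearMap.coprod_apply, ContinuousLinearMap.comp_apply, map_add,
    hC.apply_apply', hC.apply_sine]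
  module

variable [CompleteSpace Y]

variable (hC : IsCosineFunction C) (hP : IsPhaseSpace C ι)
include hC hP

theorem hasDerivAt_trajectory (p : Y × X) (t : ℝ) :
    HasDerivAt (fun t => hC.trajectory ι t p) (hP.velocity t p) t :=
  (hP.hasDerivAt_cosineDeriv p.1 t).add (hC.hasDerivAt_sine p.2 t)

theorem hasDerivAt_apply_trajectory (p : Y × X) (t τ : ℝ) :
    HasDerivAt (fun τ => C τ (hC.trajectory ι t p))
      ((1 / 2 : ℝ) • (hP.velocity (t + τ) p - hP.velocity (t - τ) p)) τ := by
  simpa only [hC.apply_trajectory, sub_eq_add_neg] using!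
    (((hC.hasDerivAt_trajectory hP p (t + τ)).comp_const_add t τ).add
      ((hC.hasDerivAt_trajectory hP p (t - τ)).comp_const_sub t τ)).const_smul (1 / 2 : ℝ)

theorem apply_velocity (p : Y × X) (t τ : ℝ) :
    C τ (hP.velocity t p) =
      (1 / 2 : ℝ) • (hP.velocity (t + τ) p + hP.velocity (t - τ) p) := by
  have hleft := hasDerivAt_clm_apply (C τ) (hC.hasDerivAt_trajectory hP p t)
  simp only [hC.apply_trajectory] at hleft
  exact hleft.unique (hasDerivAt_half_add_shift (hC.hasDerivAt_trajectory hP p) τ t)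

theorem sine_velocity (p : Y × X) (t τ : ℝ) :
    hC.sine τ (hP.velocity t p) =
      (1 / 2 : ℝ) • (hC.trajectory ι (t + τ) p - hC.trajectory ι (t - τ) p) := by
  refine congrFun (eq_of_hasDerivAt_eq (t₀ := 0)
    (g := fun τ => (1 / 2 : ℝ) • (hC.trajectory ι (t + τ) p - hC.trajectory ι (t - τ) p))
    (hC.hasDerivAt_sine _) (fun τ => ?_) ?_) τ
  · rw [hC.apply_velocity hP]
    simpa only [sub_neg_eq_add] using!
      (((hC.hasDerivAt_trajectory hP p (t + τ)).comp_const_add t τ).sub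
        ((hC.hasDerivAt_trajectory hP p (t - τ)).comp_const_sub t τ)).const_smul (1 / 2 : ℝ)
  · simp [hC.sine_zero_apply]

theorem trajectory_mem_range (t : ℝ) (p : Y × X) : hC.trajectory ι t p ∈ range ι := by
  have hv := hP.stronglyContinuous_velocity hC p
  exact hP.mem_range_of_hasDerivAt (hC.hasDerivAt_apply_trajectory hP p t) (by fun_prop)

variable (hι : Function.Injective ι)
include hι

/-- The mild solution of the abstract wave equation, as an element of the smaller space `Y`. -/
def position (t : ℝ) : Y × X →L[𝕜] Y :=
  liftOfInjective hι (hC.trajectory ι t) (hC.trajectory_mem_range hP t)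

theorem apply_position (t : ℝ) (p : Y × X) :
    ι (hC.position hP hι t p) = hC.trajectory ι t p :=
  apply_liftOfInjective ..

theorem position_zero_apply (p : Y × X) : hC.position hP hι 0 p = p.1 :=
  hι ((hC.apply_position hP hι 0 p).trans (hC.trajectory_zero_apply p))

theorem stronglyContinuous_position : StronglyContinuous (hC.position hP hι) := fun p => by
  have hv := hP.stronglyContinuous_velocity hC p
  have htraj : Continuous fun t => hC.trajectory ι t p :=
    continuous_iff_continuousAt.2 fun t => (hC.hasDerivAt_trajectory hP p t).continuousAt
  refine hP.continuous_of_continuous_deriv (fun t τ => ?_)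
    (by fun_prop : Continuous (Function.uncurry fun t τ =>
      (1 / 2 : ℝ) • (hP.velocity (t + τ) p - hP.velocity (t - τ) p)))
    (by simpa only [hC.apply_position hP hι] using htraj)
  simpa only [hC.apply_position hP hι] using hC.hasDerivAt_apply_trajectory hP p t τ

/-- The group `(y, x) ↦ (u(t), u'(t))` on the phase space, where `u` is the mild solution of the
abstract wave equation with initial data `(y, x)`. -/
def phaseGroup (t : ℝ) : Y × X →L[𝕜] Y × X := (hC.position hP hι t).prod (hP.velocity t)

theorem trajectory_phaseGroup (s t : ℝ) (p : Y × X) :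
    hC.trajectory ι s (hC.phaseGroup hP hι t p) = hC.trajectory ι (t + s) p := by
  change C s (ι (hC.position hP hι t p)) + hC.sine s (hP.velocity t p) = _
  rw [hC.apply_position, hC.apply_trajectory, hC.sine_velocity]
  module

theorem velocity_phaseGroup (s t : ℝ) (p : Y × X) :
    hP.velocity s (hC.phaseGroup hP hι t p) = hP.velocity (t + s) p := by
  have h := hC.hasDerivAt_trajectory hP (hC.phaseGroup hP hι t p) s
  simp only [hC.trajectory_phaseGroup hP hι] at h
  exact h.unique ((hC.hasDerivAt_trajectory hP p (t + s)).comp_const_add t s)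

theorem isC0Group_phaseGroup : IsC0Group (hC.phaseGroup hP hι) where
  map_zero := ContinuousLinearMap.ext fun p =>
    Prod.ext (hC.position_zero_apply hP hι p) (hP.velocity_zero_apply hC p)
  map_add s t := by
    refine ContinuousLinearMap.ext fun p => Prod.ext (hι ?_) ?_
    · change ι (hC.position hP hι (s + t) p) =
        ι (hC.position hP hι s (hC.phaseGroup hP hι t p))
      rw [hC.apply_position, hC.apply_position, hC.trajectory_phaseGroup, add_comm]
    · exact (add_comm s t ▸ hC.velocity_phaseGroup hP hι s t p).symm
  strongly_continuous :=
    (hC.stronglyContinuous_position hP hι).prod (hP.stronglyContinuous_velocity hC)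

variable [NormedSpace ℝ Y] [IsScalarTower ℝ 𝕜 Y]

theorem hasDerivAt_phaseGroup_iff {G : X →ₗ.[𝕜] X} (hG : IsCosineGenerator C G) {p q : Y × X} :
    HasDerivAt (fun t => hC.phaseGroup hP hι t p) q 0 ↔
      ι q.1 = p.2 ∧ (ι p.1, q.2) ∈ G.graph := by
  constructor
  · intro h
    have hposition : HasDerivAt (fun t => hC.trajectory ι t p) (ι q.1) 0 := by
      simpa only [← hC.apply_position hP hι] using!
        hasDerivAt_clm_apply (ι.comp (ContinuousLinearMap.fst 𝕜 Y X)) h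
    have hy : ι q.1 = p.2 := by
      rw [hposition.unique (hC.hasDerivAt_trajectory hP p 0), hP.velocity_zero_apply hC]
    exact ⟨hy, hP.mem_graph_of_hasDerivAt_velocity hC hG hy
      (hasDerivAt_clm_apply (ContinuousLinearMap.snd 𝕜 Y X) h)⟩
  · rintro ⟨hy, hmem⟩
    have hcos (t : ℝ) : hP.cosineDeriv t p.1 = hC.sine t q.2 :=
      (hP.hasDerivAt_cosineDeriv p.1 t).unique <| by
        simpa only [hC.apply_eq_add_sineIntegral ((hG _ _).1 hmem)] using
          (hC.hasDerivAt_sineIntegral q.2 t).const_add (ι p.1)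
    have hvel (t : ℝ) : hP.velocity t p = hC.trajectory ι t q := by
      change hP.cosineDeriv t p.1 + C t p.2 = C t (ι q.1) + hC.sine t q.2
      rw [hcos, hy, add_comm]
    have hposition : HasDerivAt (fun t => hC.position hP hι t p) (hC.position hP hι 0 q) 0 :=
      hasDerivAt_of_injective_clm hι (hC.stronglyContinuous_position hP hι q) (fun t => by
        simpa only [hC.apply_position hP hι, ← hvel] using hC.hasDerivAt_trajectory hP p t) 0
    have hvelocity : HasDerivAt (fun t => hP.velocity t p) q.2 0 := by
      simpa only [hvel, hP.velocity_zero_apply hC] using hC.hasDerivAt_trajectory hP q 0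
    exact (hC.position_zero_apply hP hι q ▸ hposition).prodMk hvelocity

end IsCosineFunction

/-! ### Well-posedness of first order problems -/

namespace FirstOrderProblem

variable {𝕜 E dE : Type*} [RCLike 𝕜]
  [NormedAddCommGroup E] [NormedSpace 𝕜 E] [NormedAddCommGroup dE] [NormedSpace 𝕜 dE]
  {P : FirstOrderProblem 𝕜 E dE}

theorem mem_graph_matrix_iff {z w : E × dE} : (z, w) ∈ P.matrix.graph ↔
    ∃ h : z.1 ∈ P.op.domain, P.bdry ⟨z.1, h⟩ = z.2 ∧ P.op ⟨z.1, h⟩ = w.1 ∧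
      P.feedback z.1 + P.bdryOp z.2 = w.2 := by
  rw [matrix, mem_graph_paramOp]
  constructor
  · rintro ⟨p, hp⟩
    obtain ⟨rfl, rfl⟩ := Prod.ext_iff.1 hp
    exact ⟨p.2, rfl, rfl, rfl⟩
  · rintro ⟨h, hbdry, hop, hfeedback⟩
    refine ⟨⟨z.1, h⟩, Prod.ext (Prod.ext rfl hbdry) (Prod.ext hop ?_)⟩
    rw [← hfeedback, ← hbdry]
    rfl

variable [NormedSpace ℝ E] [NormedSpace ℝ dE]

theorem IsClassicalSolution.hasDerivAt {u₀ : E} {x₀ : dE} {u : ℝ → E}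
    (hu : P.IsClassicalSolution u₀ x₀ u) (t : ℝ) :
    HasDerivAt (fun t => (u t, P.bdry ⟨u t, hu.mem t⟩))
      (P.op ⟨u t, hu.mem t⟩, P.feedback (u t) + P.bdryOp (P.bdry ⟨u t, hu.mem t⟩)) t := by
  rw [← hu.deriv_eq, ← hu.deriv_bdry_eq]
  exact (hu.contDiff.differentiable one_ne_zero t).hasDerivAt.prodMk
    (hu.contDiff_bdry.differentiable one_ne_zero t).hasDerivAt

variable [IsScalarTower ℝ 𝕜 E] [IsScalarTower ℝ 𝕜 dE]

theorem isClassicalSolution_fst {z z' : ℝ → E × dE} (hz : ∀ t, HasDerivAt z (z' t) t)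
    (hz' : Continuous z') (hgraph : ∀ t, (z t, z' t) ∈ P.matrix.graph) :
    P.IsClassicalSolution (z 0).1 (z 0).2 fun t => (z t).1 := by
  choose hmem hbdry hop hfeedback using fun t => mem_graph_matrix_iff.1 (hgraph t)
  have hfst (t : ℝ) : HasDerivAt (fun t => (z t).1) (z' t).1 t :=
    hasDerivAt_clm_apply (ContinuousLinearMap.fst 𝕜 E dE) (hz t)
  have hsnd (t : ℝ) : HasDerivAt (fun t => P.bdry ⟨(z t).1, hmem t⟩) (z' t).2 t := by
    rw [funext hbdry]
    exact hasDerivAt_clm_apply (ContinuousLinearMap.snd 𝕜 E dE) (hz t)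
  exact
    { contDiff := contDiff_one_of_hasDerivAt hfst hz'.fst
      mem := hmem
      contDiff_bdry := contDiff_one_of_hasDerivAt hsnd hz'.snd
      deriv_eq := fun t => (hfst t).deriv.trans (hop t).symm
      deriv_bdry_eq := fun t => by rw [(hsnd t).deriv, hbdry, hfeedback]
      initial := rfl
      initial_bdry := hbdry 0 }

variable {T : ℝ → (E × dE) →L[𝕜] (E × dE)} (hT : IsC0Group T)
  (hgen : ∀ z w, (z, w) ∈ P.matrix.graph ↔ HasDerivAt (fun t => T t z) w 0)
include hT hgen

theorem isClassicalSolution_apply_fst {u₀ : E} {x₀ : dE} {w : E × dE}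
    (hw : ((u₀, x₀), w) ∈ P.matrix.graph) :
    P.IsClassicalSolution u₀ x₀ fun t => (T t (u₀, x₀)).1 := by
  have hderiv := (hgen _ _).1 hw
  simpa only [hT.apply_zero] using isClassicalSolution_fst (hT.hasDerivAt hderiv)
    (hT.strongly_continuous w) fun t => (hgen _ _).2 (hT.hasDerivAt_apply_zero hderiv t)

variable [CompleteSpace E] [CompleteSpace dE]

theorem IsClassicalSolution.eq_apply {u₀ : E} {x₀ : dE} {u : ℝ → E}
    (hu : P.IsClassicalSolution u₀ x₀ u) (t : ℝ) :
    (u t, P.bdry ⟨u t, hu.mem t⟩) = T t (u₀, x₀) := by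
  have hsol := hT.eq_of_hasDerivAt hu.hasDerivAt
    (fun s => (hgen _ _).1 (mem_graph_matrix_iff.2 ⟨hu.mem s, rfl, rfl, rfl⟩)) t
  exact hsol.trans (congrArg (T t) (Prod.ext hu.initial hu.initial_bdry))

theorem existsUnique_isClassicalSolution {u₀ : E} {x₀ : dE} {w : E × dE}
    (hw : ((u₀, x₀), w) ∈ P.matrix.graph) : ∃! u, P.IsClassicalSolution u₀ x₀ u :=
  ⟨_, isClassicalSolution_apply_fst hT hgen hw,
    fun _ hv => funext fun t => congrArg Prod.fst (hv.eq_apply hT hgen t)⟩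

theorem IsClassicalSolution.norm_add_norm_le {u₀ : E} {x₀ : dE} {u : ℝ → E}
    (hu : P.IsClassicalSolution u₀ x₀ u) (t : ℝ) :
    ‖u t‖ + ‖P.bdry ⟨u t, hu.mem t⟩‖ ≤ 2 * ‖T t‖ * (‖u₀‖ + ‖x₀‖) := by
  have hbound : ‖(u t, P.bdry ⟨u t, hu.mem t⟩)‖ ≤ ‖T t‖ * (‖u₀‖ + ‖x₀‖) := by
    rw [hu.eq_apply hT hgen t]
    exact (T t).le_of_opNorm_le_of_le le_rfl
      (max_le_add_of_nonneg (norm_nonneg _) (norm_nonneg _))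
  have hfst := norm_fst_le (u t, P.bdry ⟨u t, hu.mem t⟩)
  have hsnd := norm_snd_le (u t, P.bdry ⟨u t, hu.mem t⟩)
  linarith

omit hT hgen

theorem wellPosed_of_generatesC0Group (h : GeneratesC0Group P.matrix) : P.WellPosed := by
  refine ⟨h.isClosed, h.dense_domain, fun u₀ hu₀ x₀ hx₀ => ?_, fun a => ?_⟩ <;>
    obtain ⟨T, hT, hgen⟩ := h
  · exact existsUnique_isClassicalSolution hT hgen
      (mem_graph_matrix_iff.2 ⟨hu₀, hx₀, rfl, rfl⟩ : (_, (_, _)) ∈ _)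
  · obtain ⟨M, hM⟩ := hT.stronglyContinuous.exists_norm_le a
    refine ⟨2 * M, fun u₀ x₀ u hu t ht => (hu.norm_add_norm_le hT hgen t).trans ?_⟩
    gcongr
    exact hM t ht

end FirstOrderProblem

/-! ### The second order problem and its first order reformulation -/

theorem contDiff_two_of_hasDerivAt {E : Type*} [NormedAddCommGroup E] [NormedSpace ℝ E]
    {f f' f'' : ℝ → E} (hf : ∀ t, HasDerivAt f (f' t) t) (hf' : ∀ t, HasDerivAt f' (f'' t) t)
    (hf'' : Continuous f'') : ContDiff ℝ 2 f := by
  refine (contDiff_succ_iff_deriv (n := 1)).2 ⟨fun t => (hf t).differentiableAt, by simp, ?_⟩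
  rw [funext fun t => (hf t).deriv]
  exact contDiff_one_of_hasDerivAt hf' hf''

section ProdNorm

variable {E₁ E₂ E₃ E₄ : Type*} [SeminormedAddCommGroup E₁] [SeminormedAddCommGroup E₂]
  [SeminormedAddCommGroup E₃] [SeminormedAddCommGroup E₄]

theorem norm_le_sum_norm (q : E₁ × E₂ × E₃ × E₄) :
    ‖q‖ ≤ ‖q.1‖ + ‖q.2.1‖ + ‖q.2.2.1‖ + ‖q.2.2.2‖ := by
  have h₁ := norm_nonneg q.1
  have h₂ := norm_nonneg q.2.1
  have h₃ := norm_nonneg q.2.2.1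
  have h₄ := norm_nonneg q.2.2.2
  simp only [Prod.norm_def, max_le_iff]
  refine ⟨?_, ?_, ?_, ?_⟩ <;> linarith

theorem sum_norm_le (q : E₁ × E₂ × E₃ × E₄) :
    ‖q.1‖ + ‖q.2.1‖ + ‖q.2.2.1‖ + ‖q.2.2.2‖ ≤ 4 * ‖q‖ := by
  have h₁ := norm_fst_le q
  have h₂ := norm_snd_le q
  have h₃ := (norm_fst_le q.2).trans h₂
  have h₄ := (norm_fst_le q.2.2).trans ((norm_snd_le q.2).trans h₂)
  have h₅ := (norm_snd_le q.2.2).trans ((norm_snd_le q.2).trans h₂)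
  linarith

end ProdNorm

namespace AcousticData

variable {𝕜 : Type*} [RCLike 𝕜] {Y X dX : Type*}
  [NormedAddCommGroup Y] [NormedSpace 𝕜 Y] [NormedAddCommGroup X] [NormedSpace 𝕜 X]
  [NormedAddCommGroup dX] [NormedSpace 𝕜 dX] {S : AcousticData 𝕜 Y X dX}

section Operators

theorem L_apply {u : Y} (hu : u ∈ S.A.domain) : S.L ⟨u, hu⟩ = S.R ⟨u, hu⟩ + S.B₂ u := rfl

theorem mem_graph_A₀_iff {u : Y} {b : X} : (S.ι u, b) ∈ S.A₀.graph ↔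
    ∃ h : u ∈ S.A.domain, S.R ⟨u, h⟩ = 0 ∧ S.A ⟨u, h⟩ = b := by
  rw [A₀, mem_graph_paramOp]
  constructor
  · rintro ⟨⟨p, hp⟩, h⟩
    obtain ⟨hpu, hpb⟩ := Prod.ext_iff.1 h
    obtain rfl : (p : Y) = u := S.ι_injective hpu
    exact ⟨p.2, hp, hpb⟩
  · rintro ⟨h, hR, hA⟩
    exact ⟨⟨⟨u, h⟩, hR⟩, Prod.ext rfl hA⟩

theorem firstOrder_op_apply (p : S.A.domain × Y × dX)
    (h : S.incl p ∈ S.firstOrder.op.domain) :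
    S.firstOrder.op ⟨S.incl p, h⟩ = (p.2.1, S.A p.1, S.L p.1) :=
  ((S.firstOrder.op).image_iff h).2 ((mem_graph_paramOp _ _ _ _).2 ⟨p, rfl⟩) |>.symm

theorem firstOrder_bdry_apply (p : S.A.domain × Y × dX)
    (h : S.incl p ∈ S.firstOrder.op.domain) :
    S.firstOrder.bdry ⟨S.incl p, h⟩ = S.R p.1 :=
  congrArg (fun q : S.A.domain × Y × dX => S.R q.1)
    ((LinearEquiv.ofInjective S.incl S.incl_injective).symm_apply_apply p)

theorem mem_graph_matrix_iff {u a : Y} {v b : X} {y c x d : dX} :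
    (((u, v, y), x), ((a, b, c), d)) ∈ S.firstOrder.matrix.graph ↔
      ∃ hu : u ∈ S.A.domain, S.R ⟨u, hu⟩ = x ∧ S.ι a = v ∧ S.A ⟨u, hu⟩ = b ∧
        x + S.B₂ u = c ∧ S.B₁ u + S.B₄ (S.B₂ u) + S.B₃ y + S.B₄ x = d := by
  rw [FirstOrderProblem.mem_graph_matrix_iff]
  constructor
  · rintro ⟨⟨⟨u, a', y⟩, hp⟩, hbdry, hop, hfeedback⟩
    obtain ⟨rfl, rfl, rfl⟩ : (u : Y) = _ ∧ S.ι a' = v ∧ y = _ := by simpa [incl] using hp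
    obtain rfl := (firstOrder_bdry_apply (u, a', y) _).symm.trans hbdry
    obtain ⟨rfl, rfl, rfl⟩ : a' = a ∧ S.A u = b ∧ S.L u = c := by
      simpa using (firstOrder_op_apply (u, a', y) _).symm.trans hop
    exact ⟨u.2, rfl, rfl, rfl, rfl, hfeedback⟩
  · rintro ⟨hu, rfl, rfl, rfl, rfl, hd⟩
    exact ⟨⟨(⟨u, hu⟩, a, y), rfl⟩, firstOrder_bdry_apply (⟨u, hu⟩, a, y) _,
      firstOrder_op_apply (⟨u, hu⟩, a, y) _, hd⟩

end Operators

section ClassicalSolutions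

variable [NormedSpace ℝ Y] [NormedSpace ℝ X] [NormedSpace ℝ dX]

namespace IsClassicalSolution

variable {f g : Y} {h j : dX} {u : ℝ → Y} {x : ℝ → dX} (hu : S.IsClassicalSolution f g h j u x)
include hu

theorem hasDerivAt_u (t : ℝ) : HasDerivAt u (deriv u t) t :=
  (hu.contDiff_one.differentiable one_ne_zero t).hasDerivAt

theorem mem_graph_matrix (t : ℝ) :
    (((u t, S.ι (deriv u t), x t), deriv x t - S.B₂ (u t)),
      ((deriv u t, deriv (deriv fun s => S.ι (u s)) t, deriv x t),
        deriv (deriv x) t - S.B₂ (deriv u t))) ∈ S.firstOrder.matrix.graph := by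
  refine mem_graph_matrix_iff.2
    ⟨hu.mem t, ?_, rfl, (hu.interior t).symm, sub_add_cancel _ _, ?_⟩
  · rw [hu.coupling, L_apply, add_sub_cancel_right]
  · rw [hu.boundary, map_sub]
    abel

variable [IsScalarTower ℝ 𝕜 Y] [IsScalarTower ℝ 𝕜 X]

theorem deriv_ι : (deriv fun t => S.ι (u t)) = fun t => S.ι (deriv u t) :=
  funext fun t => (hasDerivAt_clm_apply S.ι (hu.hasDerivAt_u t)).deriv

variable [IsScalarTower ℝ 𝕜 dX]

theorem hasDerivAt_state (t : ℝ) :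
    HasDerivAt (fun t => ((u t, S.ι (deriv u t), x t), deriv x t - S.B₂ (u t)))
      ((deriv u t, deriv (deriv fun s => S.ι (u s)) t, deriv x t),
        deriv (deriv x) t - S.B₂ (deriv u t)) t := by
  have hv : HasDerivAt (fun t => S.ι (deriv u t)) (deriv (deriv fun s => S.ι (u s)) t) t := by
    rw [← hu.deriv_ι]
    exact (hu.contDiff_two.deriv'.differentiable one_ne_zero t).hasDerivAt
  have hx := (hu.contDiff_bdry.differentiable two_ne_zero t).hasDerivAt
  have hx' := (hu.contDiff_bdry.deriv'.differentiable one_ne_zero t).hasDerivAt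
  exact ((hu.hasDerivAt_u t).prodMk (hv.prodMk hx)).prodMk
    (hx'.sub (hasDerivAt_clm_apply S.B₂ (hu.hasDerivAt_u t)))

theorem firstOrder : S.firstOrder.IsClassicalSolution (f, S.ι g, h) (j - S.B₂ f)
    fun t => (u t, S.ι (deriv u t), x t) := by
  have hu' : Continuous (deriv u) := hu.contDiff_one.continuous_deriv le_rfl
  have hv' : Continuous (deriv (deriv fun s => S.ι (u s))) :=
    hu.contDiff_two.deriv'.continuous_deriv le_rfl
  have hx' : Continuous (deriv x) := hu.contDiff_bdry.continuous_deriv one_le_two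
  have hx'' : Continuous (deriv (deriv x)) := hu.contDiff_bdry.deriv'.continuous_deriv le_rfl
  simpa only [hu.initial_u, hu.initial_u', hu.initial_x, hu.initial_x'] using
    FirstOrderProblem.isClassicalSolution_fst hu.hasDerivAt_state
      ((hu'.prodMk (hv'.prodMk hx')).prodMk (hx''.sub (S.B₂.continuous.comp hu')))
      hu.mem_graph_matrix

end IsClassicalSolution

variable [IsScalarTower ℝ 𝕜 Y] [IsScalarTower ℝ 𝕜 X] [IsScalarTower ℝ 𝕜 dX]

theorem isClassicalSolution_of_mem_graph {z z' : ℝ → (Y × X × dX) × dX}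
    (hz : ∀ t, HasDerivAt z (z' t) t) (hz' : Continuous z')
    (hgraph : ∀ t, (z t, z' t) ∈ S.firstOrder.matrix.graph) :
    S.IsClassicalSolution (z 0).1.1 (z' 0).1.1 (z 0).1.2.2 (z' 0).1.2.2
      (fun t => (z t).1.1) fun t => (z t).1.2.2 := by
  choose hmem hR hι hA hL hB using fun t => mem_graph_matrix_iff.1 (hgraph t)
  have hstate (t : ℝ) := hasDerivAt_clm_apply (.fst 𝕜 (Y × X × dX) dX) (hz t)
  have hu (t : ℝ) : HasDerivAt (fun t => (z t).1.1) (z' t).1.1 t :=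
    hasDerivAt_clm_apply (.fst 𝕜 Y (X × dX)) (hstate t)
  have htail (t : ℝ) := hasDerivAt_clm_apply (.snd 𝕜 Y (X × dX)) (hstate t)
  have hιu (t : ℝ) : HasDerivAt (fun t => S.ι (z t).1.1) (z t).1.2.1 t :=
    hι t ▸ hasDerivAt_clm_apply S.ι (hu t)
  have hιu' (t : ℝ) : HasDerivAt (fun t => (z t).1.2.1) (z' t).1.2.1 t :=
    hasDerivAt_clm_apply (.fst 𝕜 X dX) (htail t)
  have hx (t : ℝ) : HasDerivAt (fun t => (z t).1.2.2) (z' t).1.2.2 t :=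
    hasDerivAt_clm_apply (.snd 𝕜 X dX) (htail t)
  have hx' (t : ℝ) : HasDerivAt (fun t => (z' t).1.2.2) ((z' t).2 + S.B₂ (z' t).1.1) t := by
    rw [← funext hL]
    exact (hasDerivAt_clm_apply (.snd 𝕜 (Y × X × dX) dX) (hz t)).add
      (hasDerivAt_clm_apply S.B₂ (hu t))
  have hx'' : Continuous fun t => (z' t).2 + S.B₂ (z' t).1.1 := by fun_prop
  have hLx (t : ℝ) : S.L ⟨(z t).1.1, hmem t⟩ = (z' t).1.2.2 := by rw [L_apply, hR, hL]
  exact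
    { contDiff_two := contDiff_two_of_hasDerivAt hιu hιu' hz'.fst.snd.fst
      contDiff_one := contDiff_one_of_hasDerivAt hu hz'.fst.fst
      mem := hmem
      contDiff_L := by
        rw [funext hLx]
        exact contDiff_one_of_hasDerivAt hx' hx''
      contDiff_bdry := contDiff_two_of_hasDerivAt hx hx' hx''
      interior := fun t => by rw [funext fun s => (hιu s).deriv, (hιu' t).deriv, hA]
      boundary := fun t => by
        rw [funext fun s => (hx s).deriv, (hx' t).deriv, (hu t).deriv, ← hB]
        simp only [← hL, map_add]
        abel
      coupling := fun t => (hx t).deriv.trans (hLx t).symm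
      initial_u := rfl
      initial_u' := (hu 0).deriv
      initial_x := rfl
      initial_x' := (hx 0).deriv }

theorem isClassicalSolution_of_firstOrder {f g : Y} {h j : dX} {z : ℝ → Y × X × dX}
    (hz : S.firstOrder.IsClassicalSolution (f, S.ι g, h) (j - S.B₂ f) z) :
    S.IsClassicalSolution f g h j (fun t => (z t).1) fun t => (z t).2.2 := by
  have hgraph (t : ℝ) : ((z t, _), (deriv z t, _)) ∈ S.firstOrder.matrix.graph :=
    FirstOrderProblem.mem_graph_matrix_iff.2
      ⟨hz.mem t, rfl, (hz.deriv_eq t).symm, (hz.deriv_bdry_eq t).symm⟩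
  have hsol := isClassicalSolution_of_mem_graph (fun t =>
      (hz.contDiff.differentiable one_ne_zero t).hasDerivAt.prodMk
        (hz.contDiff_bdry.differentiable one_ne_zero t).hasDerivAt)
    ((hz.contDiff.continuous_deriv le_rfl).prodMk (hz.contDiff_bdry.continuous_deriv le_rfl)) hgraph
  obtain ⟨-, -, hι, -, hL, -⟩ := mem_graph_matrix_iff.1 (hgraph 0)
  have hg : (deriv z 0).1 = g := S.ι_injective (hι.trans (by rw [hz.initial]))
  have hj : (deriv z 0).2.2 = j :=
    hL.symm.trans (by rw [hz.initial_bdry, hz.initial, sub_add_cancel])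
  simpa only [hz.initial, hg, hj] using hsol

end ClassicalSolutions

section WellPosed

variable (S) in
/-- The change of variables `((u, v, y), x) ↦ (u, v, y, x + B₂ u)` from the states of the first
order problem to those of the second order problem: it sends the boundary value `x = R u` to
`L u`. -/
def stateEquiv : ((Y × X × dX) × dX) ≃L[𝕜] (Y × X × dX × dX) where
  toFun z := (z.1.1, z.1.2.1, z.1.2.2, z.2 + S.B₂ z.1.1)
  invFun q := ((q.1, q.2.1, q.2.2.1), q.2.2.2 - S.B₂ q.1)
  map_add' z w := by simp [add_add_add_comm]
  map_smul' a z := by simp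
  left_inv z := by simp
  right_inv q := by simp
  continuous_toFun := by fun_prop
  continuous_invFun := by fun_prop

theorem stateEquiv_apply (z : (Y × X × dX) × dX) :
    S.stateEquiv z = (z.1.1, z.1.2.1, z.1.2.2, z.2 + S.B₂ z.1.1) := rfl

theorem stateEquiv_symm_apply (q : Y × X × dX × dX) :
    S.stateEquiv.symm q = ((q.1, q.2.1, q.2.2.1), q.2.2.2 - S.B₂ q.1) := rfl

theorem dense_admissible
    (hdense : Dense (S.firstOrder.matrix.domain : Set ((Y × X × dX) × dX))) :
    Dense {q : Y × X × dX × dX | ∃ (f : S.A.domain) (g : Y) (h : dX),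
      q = ((f : Y), S.ι g, h, S.L f)} := by
  refine (S.stateEquiv.surjective.denseRange.dense_image S.stateEquiv.continuous hdense).mono ?_
  rintro _ ⟨z, hz, rfl⟩
  obtain ⟨⟨⟨a, b, c⟩, d⟩, hw⟩ := LinearPMap.mem_domain_iff.1 hz
  obtain ⟨hu, hR, hι, -⟩ := mem_graph_matrix_iff.1 hw
  exact ⟨⟨z.1.1, hu⟩, a, z.1.2.2, by rw [stateEquiv_apply, L_apply, hR, hι]⟩

variable [NormedSpace ℝ Y] [IsScalarTower ℝ 𝕜 Y] [NormedSpace ℝ X] [IsScalarTower ℝ 𝕜 X]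
  [NormedSpace ℝ dX] [IsScalarTower ℝ 𝕜 dX]

theorem existsUnique_isClassicalSolution (hW : S.firstOrder.WellPosed) {f : Y}
    (hf : f ∈ S.A.domain) (g : Y) (h : dX) :
    ∃! p : (ℝ → Y) × (ℝ → dX), S.IsClassicalSolution f g h (S.L ⟨f, hf⟩) p.1 p.2 := by
  obtain ⟨hmem, hbdry, -⟩ := FirstOrderProblem.mem_graph_matrix_iff.1
    (mem_graph_matrix_iff.2 ⟨hf, rfl, rfl, rfl, rfl, rfl⟩ :
      (((f, S.ι g, h), S.R ⟨f, hf⟩), _) ∈ S.firstOrder.matrix.graph)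
  obtain ⟨z, hz, hunique⟩ := hW.existsUnique (f, S.ι g, h) hmem (S.L ⟨f, hf⟩ - S.B₂ f)
    (by rw [hbdry, L_apply, add_sub_cancel_right])
  refine ⟨(fun t => (z t).1, fun t => (z t).2.2), isClassicalSolution_of_firstOrder hz,
    fun p hp => ?_⟩
  rw [← hunique _ hp.firstOrder]

theorem IsClassicalSolution.norm_stateEquiv_symm_le {f g : Y} {h j : dX} {u : ℝ → Y} {x : ℝ → dX}
    (hu : S.IsClassicalSolution f g h j u x) {t K : ℝ}
    (hK : ∀ (z₀ : Y × X × dX) (x₀ : dX) (z : ℝ → Y × X × dX)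
      (hz : S.firstOrder.IsClassicalSolution z₀ x₀ z),
      ‖z t‖ + ‖S.firstOrder.bdry ⟨z t, hz.mem t⟩‖ ≤ K * (‖z₀‖ + ‖x₀‖)) :
    ‖S.stateEquiv.symm (u t, S.ι (deriv u t), x t, deriv x t)‖ ≤
      2 * |K| * ‖S.stateEquiv.symm (f, S.ι g, h, j)‖ := by
  obtain ⟨_, hbdry, -⟩ := FirstOrderProblem.mem_graph_matrix_iff.1 (hu.mem_graph_matrix t)
  have hbound := hK _ _ _ hu.firstOrder
  rw [hbdry] at hbound
  rw [stateEquiv_symm_apply, stateEquiv_symm_apply]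
  calc _ ≤ ‖(u t, S.ι (deriv u t), x t)‖ + ‖deriv x t - S.B₂ (u t)‖ :=
        max_le_add_of_nonneg (norm_nonneg _) (norm_nonneg _)
    _ ≤ |K| * (‖(f, S.ι g, h)‖ + ‖j - S.B₂ f‖) :=
        hbound.trans (mul_le_mul_of_nonneg_right (le_abs_self K) (by positivity))
    _ ≤ |K| * (‖((f, S.ι g, h), j - S.B₂ f)‖ + ‖((f, S.ι g, h), j - S.B₂ f)‖) :=
        mul_le_mul_of_nonneg_left (add_le_add (norm_fst_le ((f, S.ι g, h), j - S.B₂ f))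
          (norm_snd_le ((f, S.ι g, h), j - S.B₂ f))) (abs_nonneg K)
    _ = _ := by ring

theorem exists_norm_isClassicalSolution_le (hW : S.firstOrder.WellPosed) (T : ℝ) :
    ∃ K : ℝ, ∀ (f g : Y) (h j : dX) (u : ℝ → Y) (x : ℝ → dX),
      S.IsClassicalSolution f g h j u x → ∀ t ∈ Icc (-T) T,
        ‖u t‖ + ‖S.ι (deriv u t)‖ + ‖x t‖ + ‖deriv x t‖ ≤ K * (‖f‖ + ‖S.ι g‖ + ‖h‖ + ‖j‖) := by
  obtain ⟨K, hK⟩ := hW.continuous_dependence T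
  let Φ : ((Y × X × dX) × dX) →L[𝕜] (Y × X × dX × dX) := S.stateEquiv
  let Ψ : (Y × X × dX × dX) →L[𝕜] ((Y × X × dX) × dX) := S.stateEquiv.symm
  have hΦΨ (q : Y × X × dX × dX) : Φ (Ψ q) = q := S.stateEquiv.apply_symm_apply q
  refine ⟨4 * (‖Φ‖ * (2 * |K| * ‖Ψ‖)), fun f g h j u x hu t ht => ?_⟩
  calc ‖u t‖ + ‖S.ι (deriv u t)‖ + ‖x t‖ + ‖deriv x t‖
      ≤ 4 * ‖Φ (Ψ (u t, S.ι (deriv u t), x t, deriv x t))‖ := by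
        rw [hΦΨ]
        exact sum_norm_le (u t, S.ι (deriv u t), x t, deriv x t)
    _ ≤ 4 * (‖Φ‖ * (2 * |K| * (‖Ψ‖ * (‖f‖ + ‖S.ι g‖ + ‖h‖ + ‖j‖)))) := by
        gcongr
        refine Φ.le_of_opNorm_le_of_le le_rfl
          ((hu.norm_stateEquiv_symm_le fun z₀ x₀ z hz => hK z₀ x₀ z hz t ht).trans ?_)
        gcongr
        exact Ψ.le_of_opNorm_le_of_le le_rfl (norm_le_sum_norm (f, S.ι g, h, j))
    _ = _ := by ring

theorem wellPosed₂_of_firstOrder (hW : S.firstOrder.WellPosed) : S.WellPosed₂ where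
  dense := dense_admissible hW.dense
  existsUnique := fun _ hf g h _ hj => hj ▸ existsUnique_isClassicalSolution hW hf g h
  continuous_dependence := exists_norm_isClassicalSolution_le hW

end WellPosed

end AcousticData

/-! ### Similarity and bounded perturbation -/

section Similarity

variable {𝕜 E F : Type*} [RCLike 𝕜]
  [NormedAddCommGroup E] [NormedSpace 𝕜 E] [NormedAddCommGroup F] [NormedSpace 𝕜 F]

theorem IsC0Group.conj {T : ℝ → E →L[𝕜] E} (hT : IsC0Group T) (J : E ≃L[𝕜] F) :
    IsC0Group fun t => (J : E →L[𝕜] F).comp ((T t).comp (J.symm : F →L[𝕜] E)) where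
  map_zero := by ext; simp [hT.apply_zero]
  map_add s t := by ext; simp [hT.apply_add]
  strongly_continuous _ := J.continuous.comp (hT.strongly_continuous _)

theorem IsC0Group.prodMap_id {T : ℝ → E →L[𝕜] E} (hT : IsC0Group T) :
    IsC0Group fun t => (T t).prodMap (ContinuousLinearMap.id 𝕜 F) where
  map_zero := ContinuousLinearMap.ext fun z => Prod.ext (hT.apply_zero z.1) rfl
  map_add s t := ContinuousLinearMap.ext fun z => Prod.ext (hT.apply_add s t z.1) rfl
  strongly_continuous z := (hT.strongly_continuous z.1).prodMk continuous_const

variable [NormedSpace ℝ E] [IsScalarTower ℝ 𝕜 E] [NormedSpace ℝ F] [IsScalarTower ℝ 𝕜 F]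

theorem hasDerivAt_equiv_iff (J : E ≃L[𝕜] F) {f : ℝ → E} {w : F} {t : ℝ} :
    HasDerivAt (fun s => J (f s)) w t ↔ HasDerivAt f (J.symm w) t :=
  ⟨fun h => by simpa using hasDerivAt_clm_apply (J.symm : F →L[𝕜] E) h,
    fun h => by simpa using hasDerivAt_clm_apply (J : E →L[𝕜] F) h⟩

theorem hasDerivAt_prodMap_id_iff {T : ℝ → E →L[𝕜] E} {z w : E × F} :
    HasDerivAt (fun t => (T t).prodMap (ContinuousLinearMap.id 𝕜 F) z) w 0 ↔
      HasDerivAt (fun t => T t z.1) w.1 0 ∧ w.2 = 0 := by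
  refine ⟨fun h => ⟨hasDerivAt_clm_apply (.fst 𝕜 E F) h, ?_⟩, fun h => ?_⟩
  · exact (hasDerivAt_clm_apply (.snd 𝕜 E F) h).unique (hasDerivAt_const 0 z.2)
  · exact (h.1.prodMk (hasDerivAt_const (0 : ℝ) z.2)).congr_deriv (Prod.ext rfl h.2.symm)

theorem IsC0Group.generatesC0Group_of_similar [CompleteSpace E] {U : ℝ → E →L[𝕜] E}
    (hU : IsC0Group U) (J : E ≃L[𝕜] F) (B : F →L[𝕜] E) {G : F →ₗ.[𝕜] F}
    (hG : ∀ z w, (z, w) ∈ G.graph ↔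
      HasDerivAt (fun t => U t (J.symm z)) (J.symm w - B z) 0) : GeneratesC0Group G := by
  refine ⟨_, (hU.perturbation (B.comp (J : E →L[𝕜] F))).conj J, fun z w => (hG z w).trans ?_⟩
  refine .trans ?_ (hasDerivAt_equiv_iff J).symm
  simpa using (hU.hasDerivAt_perturbation_iff (B.comp (J : E →L[𝕜] F))
    (z := J.symm z) (w := J.symm w)).symm

end Similarity

/-! ### The Dirichlet operator -/

theorem IsCosineFunction.exists_resolvent {𝕜 X Y : Type*} [RCLike 𝕜]
    [NormedAddCommGroup X] [NormedSpace ℝ X] [NormedSpace 𝕜 X] [IsScalarTower ℝ 𝕜 X]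
    [CompleteSpace X] [NormedAddCommGroup Y] [NormedSpace ℝ Y] [NormedSpace 𝕜 Y]
    [IsScalarTower ℝ 𝕜 Y] [CompleteSpace Y] {C : ℝ → X →L[𝕜] X} {ι : Y →L[𝕜] X}
    {G : X →ₗ.[𝕜] X} (hC : IsCosineFunction C) (hG : IsCosineGenerator C G)
    (hP : IsPhaseSpace C ι) (hι : Function.Injective ι) :
    ∃ c : 𝕜, ∀ f, ∃! y, (ι y, c • ι y + f) ∈ G.graph := by
  obtain ⟨μ, hμ⟩ := (hC.isC0Group_phaseGroup hP hι).exists_resolvent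
  have hgraph (y : Y) (v f : X) :
      HasDerivAt (fun t => hC.phaseGroup hP hι t (y, v)) (μ • (y, v) + (0, f)) 0 ↔
        v = μ • ι y ∧ (ι y, ((μ : 𝕜) * μ) • ι y + f) ∈ G.graph := by
    rw [hC.hasDerivAt_phaseGroup_iff hP hι hG, mul_smul, ← RCLike.real_smul_eq_coe_smul,
      ← RCLike.real_smul_eq_coe_smul]
    simp only [Prod.smul_mk, Prod.mk_add_mk, add_zero, ι.map_smul_of_tower]
    constructor <;> rintro ⟨rfl, h⟩ <;> exact ⟨rfl, h⟩
  refine ⟨μ * μ, fun f => ?_⟩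
  obtain ⟨⟨y, v⟩, hy, hunique⟩ := hμ (0, f)
  refine ⟨y, ((hgraph y v f).1 hy).2, fun y' hy' => ?_⟩
  exact congrArg Prod.fst (hunique (y', _) ((hgraph y' _ f).2 ⟨rfl, hy'⟩))

namespace AcousticData

variable {𝕜 : Type*} [RCLike 𝕜] {Y X dX : Type*}
  [NormedAddCommGroup Y] [NormedSpace 𝕜 Y] [NormedAddCommGroup X] [NormedSpace 𝕜 X]
  [NormedAddCommGroup dX] [NormedSpace 𝕜 dX] {S : AcousticData 𝕜 Y X dX}

theorem mem_graph_opAR_iff {u : Y} {b : X} {x : dX} : (u, (b, x)) ∈ S.opAR.graph ↔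
    ∃ h : u ∈ S.A.domain, S.A ⟨u, h⟩ = b ∧ S.R ⟨u, h⟩ = x := by
  rw [LinearPMap.mem_graph_iff]
  constructor
  · rintro ⟨p, rfl, h⟩
    exact ⟨p.2, congrArg Prod.fst h, congrArg Prod.snd h⟩
  · rintro ⟨h, rfl, rfl⟩
    exact ⟨⟨u, h⟩, rfl, rfl⟩

variable (S) in
/-- The operator `u ↦ (A u - c u, R u)` on `D(A)` of the abstract boundary value problem
`A u - c u = f`, `R u = x`. -/
def boundaryValueMap (c : 𝕜) : S.A.domain →ₗ[𝕜] X × dX :=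
  (S.A.toFun - c • S.ι.toLinearMap ∘ₗ S.A.domain.subtype).prod S.R

theorem boundaryValueMap_eq_iff {c : 𝕜} {p : S.A.domain} {f : X} {x : dX} :
    S.boundaryValueMap c p = (f, x) ↔ S.A p = c • S.ι p + f ∧ S.R p = x := by
  rw [← sub_eq_iff_eq_add', ← Prod.mk.injEq]
  rfl

theorem bijective_boundaryValueMap (hR : Function.Surjective S.R) {c : 𝕜}
    (hc : ∀ f, ∃! u, (S.ι u, c • S.ι u + f) ∈ S.A₀.graph) :
    Function.Bijective (S.boundaryValueMap c) := by
  have hA₀ (f : X) (u : Y) : (S.ι u, c • S.ι u + f) ∈ S.A₀.graph ↔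
      ∃ h : u ∈ S.A.domain, S.boundaryValueMap c ⟨u, h⟩ = (f, 0) := by
    simp only [mem_graph_A₀_iff, boundaryValueMap_eq_iff, and_comm]
  simp only [hA₀] at hc
  constructor
  · refine (injective_iff_map_eq_zero _).2 fun p hp => Subtype.ext ?_
    exact (hc 0).unique ⟨p.2, hp⟩ ⟨zero_mem _, map_zero (S.boundaryValueMap c)⟩
  · rintro ⟨f, x⟩
    obtain ⟨p, rfl⟩ := hR x
    obtain ⟨w, ⟨hw, hwp⟩, -⟩ := hc (f - (S.boundaryValueMap c p).1)
    refine ⟨⟨w, hw⟩ + p, ?_⟩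
    rw [map_add, hwp]
    exact Prod.ext (sub_add_cancel _ _) (zero_add _)

variable (S) in
/-- `D` is the Dirichlet operator at `c`: the boundary value problem `A u = c u`, `R u = x` is
solved by `u = D x`. -/
structure IsDirichletOperator (c : 𝕜) (D : dX →L[𝕜] Y) : Prop where
  mem : ∀ x, D x ∈ S.A.domain
  A_apply : ∀ x, S.A ⟨D x, mem x⟩ = c • S.ι (D x)
  R_apply : ∀ x, S.R ⟨D x, mem x⟩ = x

theorem exists_isDirichletOperator [CompleteSpace Y] [CompleteSpace dX] (hclosed : S.opAR.IsClosed)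
    {c : 𝕜} (hc : Function.Bijective (S.boundaryValueMap c)) :
    ∃ D, S.IsDirichletOperator c D := by
  let Λ := LinearEquiv.ofBijective (S.boundaryValueMap c) hc
  let D : dX →ₗ[𝕜] Y := S.A.domain.subtype ∘ₗ Λ.symm.toLinearMap ∘ₗ LinearMap.inr 𝕜 X dX
  have hD (x : dX) : S.boundaryValueMap c (Λ.symm (0, x)) = (0, x) := Λ.apply_symm_apply _
  simp only [boundaryValueMap_eq_iff, add_zero] at hD
  have hgraph : (D.graph : Set (dX × Y)) = {q | (q.2, (c • S.ι q.2, q.1)) ∈ S.opAR.graph} := by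
    ext ⟨x, u⟩
    simp only [SetLike.mem_coe, LinearMap.mem_graph_iff, mem_ofPred_eq, mem_graph_opAR_iff]
    constructor
    · rintro rfl
      exact ⟨(Λ.symm (0, x)).2, hD x⟩
    · rintro ⟨hu, hA, hR⟩
      have hΛ : Λ ⟨u, hu⟩ = (0, x) := boundaryValueMap_eq_iff.2 ⟨hA.trans (add_zero _).symm, hR⟩
      exact congrArg Subtype.val (Λ.eq_symm_apply.2 hΛ)
  have hD_closed : IsClosed (D.graph : Set (dX × Y)) :=
    hgraph ▸ hclosed.preimage (by fun_prop : Continuous fun q : dX × Y => (q.2, c • S.ι q.2, q.1))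
  exact ⟨.ofIsClosedGraph hD_closed, fun x => (Λ.symm (0, x)).2, fun x => (hD x).1,
    fun x => (hD x).2⟩

theorem IsDirichletOperator.mem_graph_A₀_iff {c : 𝕜} {D : dX →L[𝕜] Y}
    (hD : S.IsDirichletOperator c D) {u : Y} {b : X} {x : dX} :
    (S.ι (u - D x), b - c • S.ι (D x)) ∈ S.A₀.graph ↔
      ∃ h : u ∈ S.A.domain, S.R ⟨u, h⟩ = x ∧ S.A ⟨u, h⟩ = b := by
  have hsub (hu : u ∈ S.A.domain) (h : u - D x ∈ S.A.domain) :
      S.R ⟨u - D x, h⟩ = S.R ⟨u, hu⟩ - x ∧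
        S.A ⟨u - D x, h⟩ = S.A ⟨u, hu⟩ - c • S.ι (D x) := by
    rw [← hD.A_apply, ← S.A.map_sub]
    exact ⟨(S.R.map_sub ⟨u, hu⟩ ⟨D x, hD.mem x⟩).trans (by rw [hD.R_apply]), rfl⟩
  rw [AcousticData.mem_graph_A₀_iff]
  constructor
  · rintro ⟨h, hR, hA⟩
    have hu : u ∈ S.A.domain := ((S.A.domain.sub_mem_iff_left (hD.mem x)).1 h)
    rw [(hsub hu h).1, sub_eq_zero] at hR
    rw [(hsub hu h).2, sub_left_inj] at hA
    exact ⟨hu, hR, hA⟩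
  · rintro ⟨hu, rfl, rfl⟩
    have h := S.A.domain.sub_mem hu (hD.mem (S.R ⟨u, hu⟩))
    exact ⟨h, (hsub hu h).1.trans (sub_self _), (hsub hu h).2⟩

/-! ### Generation -/

/-- The change of variables `((w, v), (y, x)) ↦ ((w + D x, v, y), x)`. For a Dirichlet operator
`D` it turns the coupling `R u = x` of `u = w + D x` into `R w = 0`. -/
def shearEquiv (D : dX →L[𝕜] Y) : ((Y × X) × dX × dX) ≃L[𝕜] ((Y × X × dX) × dX) where
  toFun p := ((p.1.1 + D p.2.2, p.1.2, p.2.1), p.2.2)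
  invFun q := ((q.1.1 - D q.2, q.1.2.1), (q.1.2.2, q.2))
  map_add' p q := by simp [add_add_add_comm]
  map_smul' a p := by simp
  left_inv p := by simp
  right_inv q := by simp
  continuous_toFun := by fun_prop
  continuous_invFun := by fun_prop

theorem shearEquiv_symm_apply (D : dX →L[𝕜] Y) (q : (Y × X × dX) × dX) :
    (shearEquiv D).symm q = ((q.1.1 - D q.2, q.1.2.1), (q.1.2.2, q.2)) := rfl

variable (S) in
/-- The bottom row `(𝔹 𝔹')` of the operator matrix. -/
def boundaryRow : (Y × X × dX) × dX →L[𝕜] dX := S.firstOrder.feedback.coprod S.firstOrder.bdryOp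

theorem boundaryRow_apply (q : (Y × X × dX) × dX) : S.boundaryRow q =
    S.B₁ q.1.1 + S.B₄ (S.B₂ q.1.1) + S.B₃ q.1.2.2 + S.B₄ q.2 := rfl

variable (S) in
/-- The bounded part that remains of the operator matrix, in the variables of `shearEquiv D`,
besides the generator of the phase space group of `A₀`. -/
def shearedPerturbation (c : 𝕜) (D : dX →L[𝕜] Y) :
    (Y × X × dX) × dX →L[𝕜] (Y × X) × dX × dX :=
  ((-(D ∘L S.boundaryRow)).prod (c • S.ι ∘L D ∘L .snd 𝕜 _ _)).prod
    ((.snd 𝕜 _ _ + S.B₂ ∘L .fst 𝕜 _ _ ∘L .fst 𝕜 _ _).prod S.boundaryRow)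

theorem shearedPerturbation_apply (c : 𝕜) (D : dX →L[𝕜] Y) (q : (Y × X × dX) × dX) :
    S.shearedPerturbation c D q = ((-D (S.boundaryRow q), c • S.ι (D q.2)),
      (q.2 + S.B₂ q.1.1, S.boundaryRow q)) := rfl

variable [NormedSpace ℝ Y] [IsScalarTower ℝ 𝕜 Y] [NormedSpace ℝ X] [IsScalarTower ℝ 𝕜 X]
  [NormedSpace ℝ dX] [IsScalarTower ℝ 𝕜 dX] [CompleteSpace Y] [CompleteSpace X] [CompleteSpace dX]

theorem IsDirichletOperator.generatesC0Group {c : 𝕜} {D : dX →L[𝕜] Y}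
    (hD : S.IsDirichletOperator c D) {C : ℝ → X →L[𝕜] X} (hC : IsCosineFunction C)
    (hG : IsCosineGenerator C S.A₀) (hP : IsPhaseSpace C S.ι) :
    GeneratesC0Group S.firstOrder.matrix := by
  refine ((hC.isC0Group_phaseGroup hP S.ι_injective).prodMap_id
    (F := dX × dX)).generatesC0Group_of_similar (shearEquiv D) (S.shearedPerturbation c D) ?_
  rintro ⟨⟨u, v, y⟩, x⟩ ⟨⟨a, b, e⟩, d⟩
  rw [hasDerivAt_prodMap_id_iff, hC.hasDerivAt_phaseGroup_iff hP S.ι_injective hG,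
    mem_graph_matrix_iff]
  simp only [shearEquiv_symm_apply, shearedPerturbation_apply, boundaryRow_apply,
    Prod.mk_sub_mk, Prod.mk_eq_zero, sub_eq_zero, hD.mem_graph_A₀_iff]
  constructor
  · rintro ⟨hu, hR, hι, hA, rfl, rfl⟩
    exact ⟨⟨by rw [sub_neg_eq_add, sub_add_cancel, hι], hu, hR, hA⟩, rfl, rfl⟩
  · rintro ⟨⟨hι, hu, hR, hA⟩, rfl, rfl⟩
    rw [sub_neg_eq_add, sub_add_cancel] at hι
    exact ⟨hu, hR, hι, hA, rfl, rfl⟩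

theorem Assumptions.generatesC0Group (hS : S.Assumptions) :
    GeneratesC0Group S.firstOrder.matrix := by
  obtain ⟨C, hC, hG, hP⟩ := hS.cosine
  obtain ⟨c, hc⟩ := hC.exists_resolvent hG hP S.ι_injective
  obtain ⟨D, hD⟩ :=
    exists_isDirichletOperator hS.closed (bijective_boundaryValueMap hS.surjective hc)
  exact hD.generatesC0Group hC hG hP

end AcousticData

end AcousticBC

end

theorem proposition2p4 {𝕜 : Type*} [RCLike 𝕜] {Y X dX : Type*}
    [NormedAddCommGroup Y] [NormedSpace ℝ Y] [NormedSpace 𝕜 Y] [IsScalarTower ℝ 𝕜 Y]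
    [CompleteSpace Y]
    [NormedAddCommGroup X] [NormedSpace ℝ X] [NormedSpace 𝕜 X] [IsScalarTower ℝ 𝕜 X]
    [CompleteSpace X]
    [NormedAddCommGroup dX] [NormedSpace ℝ dX] [NormedSpace 𝕜 dX] [IsScalarTower ℝ 𝕜 dX]
    [CompleteSpace dX]
    (S : AcousticBC.AcousticData 𝕜 Y X dX) (hS : S.Assumptions) :
    S.firstOrder.WellPosed ∧ S.WellPosed₂ ∧
      AcousticBC.GeneratesC0Group S.firstOrder.matrix := by
  have hG := hS.generatesC0Group
  have hW := AcousticBC.FirstOrderProblem.wellPosed_of_generatesC0Group hG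
  exact ⟨hW, AcousticBC.AcousticData.wellPosed₂_of_firstOrder hW, hG⟩
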